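/- Manifolds are smooth Hausdorff manifolds modelled on convenient locally convex spaces (so finite-dimensional, Banach and Fréchet manifolds are included); no second countability is imposed. A *surjection admitting local sections* is a smooth surjection $\pi\colon X\to M$ of manifolds such that every point of $M$ has an open neighbourhood with a smooth section of $\pi$, and whose fibre products $X^{[p]}=X\times_M\cdots\times_M X$ are manifolds. A *bundle gerbe* $(Q,Y,N)$ consists of a surjection $Y\to N$ admitting local sections, a principal $\mathbb C^\times$-bundle $Q\to Y^{[2]}$, and an associative product, i.e. an isomorphism of $\mathbb C^\times$-bundles over $Y^{[3]}$ given on fibres by $Q_{(y_2,y_3)}\otimes Q_{(y_1,y_2)}\to Q_{(y_1,y_3)}$. A *simplicial bundle gerbe* on a simplicial manifold $X_\bullet$ with face maps $d_i$ consists of 1. a bundle gerbe $(Q,Y,X_1)$ on $X_1$; 2. a bundle gerbe morphism $m=(\hat m,m)\colon d_0^{-1}Q\otimes d_2^{-1}Q\to d_1^{-1}Q$ over $X_2$: a smooth map $m$ of the underlying spaces over $X_2$ and a morphism $\hat m$ of $\mathbb C^\times$-bundles covering $m^{[2]}$ and preserving the bundle gerbe products; 3. a transformation $a\colon m_1\Rightarrow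 m_2$ over $X_3$, where $m_1=d_2^{-1}m\circ(d_0^{-1}m\otimes 1)$ and $m_2=d_1^{-1}m\circ(1\otimes d_3^{-1}m)$, i.e. a smooth section $\hat a$ of $(m_1,m_2)^{-1}Q$ with $\hat a(y')\,\hat m_1(u)=\hat m_2(u)\,\hat a(y)$ for every $u$ over $(y,y')$; such that over $X_4$ the coherency condition $d_0^{-1}a\otimes d_1^{-1}a^*\otimes d_2^{-1}a\otimes d_3^{-1}a^*\otimes d_4^{-1}a=1$ holds, i.e. $(1\circ d_4^{-1}a)(d_2^{-1}a)(d_0^{-1}a\circ 1)=(d_1^{-1}a)(d_3^{-1}a)$ as transformations from $((y_{45}y_{34})y_{23})y_{12}$ to $y_{45}(y_{34}(y_{23}y_{12}))$. A *bundle 2-gerbe* is a quadruple of manifolds $(Q,Y,X,M)$ with a surjection $\pi\colon X\to M$ admitting local sections and the structure of a simplicial bundle gerbe $(Q,Y,X^{[2]})$ on the simplicial manifold $X_p=X^{[p+1]}$, whose faces omit a factor. **Proposition.** Let $G$ be a Lie group, $M$ a manifold, and $\pi\colon P\to M$ a principal $G$-bundle. Let $NG$ be the simplicial manifold with $NG_n=G^n$,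 $d_0(g_1,\dots,g_n)=(g_2,\dots,g_n)$, $d_i(g_1,\dots,g_n)=(g_1,\dots,g_ig_{i+1},\dots,g_n)$ for $0<i<n$ and $d_n(g_1,\dots,g_n)=(g_1,\dots,g_{n-1})$. Define $\tau\colon P^{[2]}\to G$ by $p_2=p_1\tau(p_1,p_2)$ and, for $q\ge 1$, $\tau\colon P^{[q]}\to G^{q-1}$ by $\tau(p_1,\dots,p_q)=(\tau(p_1,p_2),\dots,\tau(p_{q-1},p_q))$. Then $\tau$ is a smooth simplicial map $P^{[\bullet+1]}\to NG$, and for every simplicial bundle gerbe $(Q,Y,G)$ on $NG$ with morphism $m$ and transformation $a$, the quadruple $(\tilde Q,\tilde P,P,M)$ is a bundle 2-gerbe, where $(\tilde Q,\tilde P,P^{[2]})=\tau^{-1}(Q,Y,G)$ is the pullback bundle gerbe, $\tilde P=P^{[2]}\times_GY$, with the morphism and the transformation obtained from $m$ and $a$ by pulling back along $\tau$. -/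

import Mathlib

open Diffeology
open scoped ContDiff Topology

universe u

namespace BundleGerbes

/-! ### Diffeologies on subspaces, products and the multiplicative group of the complex numbers -/

/-- The pullback diffeology along a map: `p` is a plot iff `f ∘ p` is a plot. -/
@[reducible]
def inducedDiffeology {X Y : Type*} [DiffeologicalSpace Y] (f : X → Y) : DiffeologicalSpace X where
  plots n := {p | IsPlot (n := n) (f ∘ p)}
  constant_plots x := isPlot_const (x := f x)
  plot_reparam hp hf := isPlot_reparam hp hf
  locality hp := DiffeologicalSpace.locality fun x => by
    obtain ⟨v, hv, hx, h⟩ := hp x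
    exact ⟨v, hv, hx, fun hf hs => h hf hs⟩

/-- The subspace diffeology. -/
instance instSubtype {X : Type*} [DiffeologicalSpace X] {p : X → Prop} :
    DiffeologicalSpace (Subtype p) :=
  inducedDiffeology Subtype.val

/-- The product diffeology: plots are the maps with both components plots. -/
instance instProd {X Y : Type*} [DiffeologicalSpace X] [DiffeologicalSpace Y] :
    DiffeologicalSpace (X × Y) where
  plots n := {p | IsPlot (n := n) (fun t => (p t).1) ∧ IsPlot (n := n) (fun t => (p t).2)}
  constant_plots x := ⟨isPlot_const (x := x.1), isPlot_const (x := x.2)⟩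
  plot_reparam hp hf := ⟨isPlot_reparam hp.1 hf, isPlot_reparam hp.2 hf⟩
  locality hp := by
    constructor
    · exact DiffeologicalSpace.locality fun x => by
        obtain ⟨v, hv, hx, h⟩ := hp x
        exact ⟨v, hv, hx, fun hf hs => (h hf hs).1⟩
    · exact DiffeologicalSpace.locality fun x => by
        obtain ⟨v, hv, hx, h⟩ := hp x
        exact ⟨v, hv, hx, fun hf hs => (h hf hs).2⟩

/-- The product diffeology on a family: plots are the maps with all components plots. -/
instance instPi {ι : Type*} {X : ι → Type*} [∀ i, DiffeologicalSpace (X i)] :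
    DiffeologicalSpace (∀ i, X i) where
  plots n := {p | ∀ i, IsPlot (n := n) (fun t => p t i)}
  constant_plots x := fun i => isPlot_const (x := x i)
  plot_reparam hp hf := fun i => isPlot_reparam (hp i) hf
  locality hp := fun i => DiffeologicalSpace.locality fun x => by
    obtain ⟨v, hv, hx, h⟩ := hp x
    exact ⟨v, hv, hx, fun hf hs => h hf hs i⟩

/-- `ℂˣ` as a smooth space: a map into it is a plot iff it is smooth as a map into `ℂ`. -/
noncomputable instance instUnitsComplex : DiffeologicalSpace ℂˣ :=
  @inducedDiffeology ℂˣ ℂ (NormedSpace.toDiffeology ℂ) Units.val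

/-! ### Smooth manifolds, possibly infinite dimensional

Manifolds are modelled on convenient vector spaces (this includes `ℝⁿ`, Banach and Fréchet
spaces), and are encoded by their smooth parametrisations, i.e. as diffeological spaces that are
locally diffeomorphic to open subsets of convenient vector spaces. -/

/-- A convenient vector space: a Hausdorff locally convex real vector space which is Mackey
complete. The latter is expressed by its standard characterisation that a curve all of whose
images under continuous linear functionals are smooth is itself smooth (it suffices to ask that
it be differentiable, since its derivative is again such a curve). -/
structure ConvenientSpace where
  /-- the underlying type -/
  carrier : Type u
  [addCommGroup : AddCommGroup carrier]
  [module : Module ℝ carrier]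
  [topology : TopologicalSpace carrier]
  [addGroup : IsTopologicalAddGroup carrier]
  [continuousSMul : ContinuousSMul ℝ carrier]
  [locallyConvex : LocallyConvexSpace ℝ carrier]
  [t2 : T2Space carrier]
  differentiable_of_scalarwise : ∀ c : ℝ → carrier,
    (∀ l : carrier →L[ℝ] ℝ, ContDiff ℝ ∞ (fun t => l (c t))) →
      ∀ t : ℝ, ∃ v : carrier, Filter.Tendsto (slope c t) (𝓝[≠] t) (𝓝 v)

attribute [instance] ConvenientSpace.addCommGroup ConvenientSpace.module
  ConvenientSpace.topology ConvenientSpace.addGroup ConvenientSpace.continuousSMul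
  ConvenientSpace.locallyConvex ConvenientSpace.t2

/-- The smooth maps from `ℝⁿ` to a convenient vector space: those which are smooth after
composition with every continuous linear functional. -/
instance ConvenientSpace.instDiffeology (E : ConvenientSpace.{u}) :
    DiffeologicalSpace E.carrier where
  plots n := {p | ∀ l : E.carrier →L[ℝ] ℝ, ContDiff ℝ ∞ (fun t => l (p t))}
  constant_plots x := fun _ => contDiff_const
  plot_reparam hp hf := fun l => (hp l).comp hf
  locality hp := fun l => by
    have := DiffeologicalSpace.locality (X := ℝ) (p := fun t => l (_ : E.carrier)) fun x => by
      obtain ⟨v, hv, hx, h⟩ := hp x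
      exact ⟨v, hv, hx, fun hf hs => h hf hs l⟩
    exact this

/-- A diffeological space is a smooth manifold if its topology is Hausdorff and every point has an
open neighbourhood diffeomorphic to an open subset of a convenient vector space. -/
structure IsSmoothManifold (X : Type u) [DiffeologicalSpace X] : Prop where
  t2 : @T2Space X dTopology
  chart : ∀ x : X, ∃ (E : ConvenientSpace.{u}) (U : Set X) (V : Set E.carrier) (φ : U ≃ V),
    x ∈ U ∧ IsOpen[dTopology] U ∧ IsOpen[dTopology] V ∧ DSmooth φ ∧ DSmooth φ.symm

/-- Lie groups. -/
structure IsLieGroup (G : Type u) [Group G] [DiffeologicalSpace G] : Prop where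
  manifold : IsSmoothManifold G
  smooth_mul : DSmooth fun p : G × G => p.1 * p.2
  smooth_inv : DSmooth fun g : G => g⁻¹

/-- The `(p+1)`-fold fibre product `X^{[p+1]}` of `π : X → M` with itself. -/
def FibrePower {X M : Type*} (π : X → M) (p : ℕ) : Type _ :=
  {x : Fin (p + 1) → X // ∀ i j, π (x i) = π (x j)}

instance {X M : Type*} [DiffeologicalSpace X] (π : X → M) (p : ℕ) :
    DiffeologicalSpace (FibrePower π p) :=
  inferInstanceAs (DiffeologicalSpace {x : Fin (p + 1) → X // ∀ i j, π (x i) = π (x j)})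

/-- `π : X → M` is a smooth surjection of manifolds admitting local sections; as usual it is
understood that its fibre products `X^{[p]}` (among them `X^{[1]} = X`) are manifolds, which is
automatic for submersions. -/
structure IsLocallySplit {X M : Type u} [DiffeologicalSpace X] [DiffeologicalSpace M]
    (π : X → M) : Prop where
  smooth : DSmooth π
  surjective : Function.Surjective π
  localSection : ∀ b : M, ∃ (U : Set M) (s : U → X),
    b ∈ U ∧ IsOpen[dTopology] U ∧ DSmooth s ∧ ∀ t : U, π (s t) = t
  manifold_base : IsSmoothManifold M
  manifold_fibrePower : ∀ p : ℕ, IsSmoothManifold (FibrePower π p)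

/-! ### Principal bundles -/

/-- `π : P → B` is a (locally trivial) principal bundle with structure group `G` for the right
action `ρ p g = p · g`. -/
structure IsPrincipalBundle {G P B : Type*} [Group G] [DiffeologicalSpace G]
    [DiffeologicalSpace P] [DiffeologicalSpace B] (π : P → B) (ρ : P → G → P) : Prop where
  smooth_proj : DSmooth π
  smooth_act : DSmooth fun q : P × G => ρ q.1 q.2
  act_one : ∀ p, ρ p 1 = p
  act_mul : ∀ p g h, ρ p (g * h) = ρ (ρ p g) h
  proj_act : ∀ p g, π (ρ p g) = π p
  localTriv : ∀ b : B, ∃ (U : Set B) (φ : U × G ≃ (π ⁻¹' U : Set P)),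
    b ∈ U ∧ IsOpen[dTopology] U ∧ DSmooth φ ∧ DSmooth φ.symm ∧
    (∀ (t : U) (g : G), π (φ (t, g)) = t) ∧
    ∀ (t : U) (g h : G), (φ (t, g * h) : P) = ρ (φ (t, g)) h

namespace IsPrincipalBundle

variable {G P B : Type*} [Group G] [DiffeologicalSpace G] [DiffeologicalSpace P]
  [DiffeologicalSpace B] {π : P → B} {ρ : P → G → P}

theorem surjective (h : IsPrincipalBundle π ρ) : Function.Surjective π := fun b => by
  obtain ⟨U, φ, hb, -, -, -, hφ, -⟩ := h.localTriv b
  exact ⟨φ (⟨b, hb⟩, 1), hφ ⟨b, hb⟩ 1⟩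

/-- The group acts simply transitively on the fibres. -/
theorem existsUnique_act (h : IsPrincipalBundle π ρ) {p q : P} (hpq : π p = π q) :
    ∃! g : G, ρ p g = q := by
  obtain ⟨U, φ, hb, -, -, -, hφ, hact⟩ := h.localTriv (π p)
  obtain ⟨⟨t, k⟩, hk⟩ := φ.surjective ⟨p, hb⟩
  obtain ⟨⟨t', l⟩, hl⟩ := φ.surjective ⟨q, show π q ∈ U from hpq ▸ hb⟩
  have e1 : (φ (t, k) : P) = p := congrArg Subtype.val hk
  have e2 : (φ (t', l) : P) = q := congrArg Subtype.val hl
  have ht : t = t' := Subtype.ext (by rw [← hφ t k, ← hφ t' l, e1, e2, hpq])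
  subst ht
  refine ⟨k⁻¹ * l, ?_, fun g hg => ?_⟩
  · show ρ p (k⁻¹ * l) = q
    rw [← e1, ← hact, mul_inv_cancel_left, e2]
  · have hg' : ρ p g = q := hg
    rw [← e1, ← hact, ← e2] at hg'
    have := congrArg Prod.snd (φ.injective (Subtype.ext hg'))
    simp only at this
    rw [← this, inv_mul_cancel_left]

/-- For `p`, `q` in the same fibre, the element `g` with `q = p · g`. -/
noncomputable def div (h : IsPrincipalBundle π ρ) {p q : P} (hpq : π p = π q) : G :=
  (h.existsUnique_act hpq).choose

theorem act_div (h : IsPrincipalBundle π ρ) {p q : P} (hpq : π p = π q) :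
    ρ p (h.div hpq) = q :=
  (h.existsUnique_act hpq).choose_spec.1

theorem div_unique (h : IsPrincipalBundle π ρ) {p q : P} (hpq : π p = π q) {g : G}
    (hg : ρ p g = q) : g = h.div hpq :=
  (h.existsUnique_act hpq).choose_spec.2 g hg

end IsPrincipalBundle

/-! ### Simplicial spaces and simplicial manifolds -/

/-- A simplicial object in smooth spaces (smoothness of the structure maps and the manifold
condition are recorded in `SimplicialSpace.IsSimplicialManifold`): a contravariant functor on the
category of the finite ordinals `{0, …, n}` and monotone maps. -/
structure SimplicialSpace where
  /-- the space of `n`-simplices -/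
  obj : ℕ → Type u
  [diffeology : ∀ n, DiffeologicalSpace (obj n)]
  /-- the map induced by a monotone map -/
  map : ∀ {m n : ℕ}, (Fin (m + 1) →o Fin (n + 1)) → obj n → obj m
  map_id : ∀ {n : ℕ} (x : obj n), map OrderHom.id x = x
  map_comp : ∀ {l m n : ℕ} (θ : Fin (m + 1) →o Fin (n + 1)) (η : Fin (l + 1) →o Fin (m + 1))
    (x : obj n), map (θ.comp η) x = map η (map θ x)

attribute [instance] SimplicialSpace.diffeology

namespace SimplicialSpace

/-- The face operator `d_i`, which omits the vertex `i`. -/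
def d (X : SimplicialSpace.{u}) {n : ℕ} (i : Fin (n + 2)) : X.obj (n + 1) → X.obj n :=
  X.map (Fin.succAboveOrderEmb i).toOrderHom

/-- The simplicial identities between face operators. -/
theorem d_d (X : SimplicialSpace.{u}) {n : ℕ} {i j : Fin (n + 2)} (hij : i ≤ j)
    (x : X.obj (n + 2)) : X.d i (X.d j.succ x) = X.d j (X.d i.castSucc x) := by
  unfold d
  rw [← X.map_comp, ← X.map_comp]
  congr 1
  ext k : 2
  have h := SimplexCategory.δ_comp_δ (n := n) hij
  exact congrArg (fun f : SimplexCategory.mk n ⟶ SimplexCategory.mk (n + 2) =>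
    f.toOrderHom k) h

/-- The simplicial identities between the faces of a `3`-simplex. -/
theorem d_d_two (X : SimplicialSpace.{u}) (x : X.obj 3) :
    X.d 0 (X.d 1 x) = X.d 0 (X.d 0 x) ∧ X.d 0 (X.d 2 x) = X.d 1 (X.d 0 x) ∧
    X.d 0 (X.d 3 x) = X.d 2 (X.d 0 x) ∧ X.d 1 (X.d 2 x) = X.d 1 (X.d 1 x) ∧
    X.d 1 (X.d 3 x) = X.d 2 (X.d 1 x) ∧ X.d 2 (X.d 3 x) = X.d 2 (X.d 2 x) :=
  ⟨X.d_d (i := 0) (j := 0) (by decide) x, X.d_d (i := 0) (j := 1) (by decide) x,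
    X.d_d (i := 0) (j := 2) (by decide) x, X.d_d (i := 1) (j := 1) (by decide) x,
    X.d_d (i := 1) (j := 2) (by decide) x, X.d_d (i := 2) (j := 2) (by decide) x⟩

/-- The simplicial identities between the faces of a `4`-simplex. -/
theorem d_d_three (X : SimplicialSpace.{u}) (x : X.obj 4) :
    X.d 0 (X.d 1 x) = X.d 0 (X.d 0 x) ∧ X.d 0 (X.d 2 x) = X.d 1 (X.d 0 x) ∧
    X.d 0 (X.d 3 x) = X.d 2 (X.d 0 x) ∧ X.d 0 (X.d 4 x) = X.d 3 (X.d 0 x) ∧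
    X.d 1 (X.d 2 x) = X.d 1 (X.d 1 x) ∧ X.d 1 (X.d 3 x) = X.d 2 (X.d 1 x) ∧
    X.d 1 (X.d 4 x) = X.d 3 (X.d 1 x) ∧ X.d 2 (X.d 3 x) = X.d 2 (X.d 2 x) ∧
    X.d 2 (X.d 4 x) = X.d 3 (X.d 2 x) ∧ X.d 3 (X.d 4 x) = X.d 3 (X.d 3 x) :=
  ⟨X.d_d (i := 0) (j := 0) (by decide) x, X.d_d (i := 0) (j := 1) (by decide) x,
    X.d_d (i := 0) (j := 2) (by decide) x, X.d_d (i := 0) (j := 3) (by decide) x,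
    X.d_d (i := 1) (j := 1) (by decide) x, X.d_d (i := 1) (j := 2) (by decide) x,
    X.d_d (i := 1) (j := 3) (by decide) x, X.d_d (i := 2) (j := 2) (by decide) x,
    X.d_d (i := 2) (j := 3) (by decide) x, X.d_d (i := 3) (j := 3) (by decide) x⟩

/-- A simplicial manifold: all levels are manifolds and all structure maps are smooth. -/
structure IsSimplicialManifold (X : SimplicialSpace.{u}) : Prop where
  manifold : ∀ n, IsSmoothManifold (X.obj n)
  smooth : ∀ {m n : ℕ} (θ : Fin (m + 1) →o Fin (n + 1)), DSmooth (X.map θ)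

end SimplicialSpace

/-- A map of simplicial spaces. -/
structure SimplicialMap (X Y : SimplicialSpace.{u}) where
  /-- the map on `n`-simplices -/
  app : ∀ n, X.obj n → Y.obj n
  naturality : ∀ {m n : ℕ} (θ : Fin (m + 1) →o Fin (n + 1)) (x : X.obj n),
    app m (X.map θ x) = Y.map θ (app n x)

namespace SimplicialMap

/-- Smoothness of a simplicial map, level by level. -/
def IsSmooth {X Y : SimplicialSpace.{u}} (f : SimplicialMap X Y) : Prop :=
  ∀ n, DSmooth (f.app n)

theorem app_d {X Y : SimplicialSpace.{u}} (f : SimplicialMap X Y) {n : ℕ} (i : Fin (n + 2))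
    (x : X.obj (n + 1)) : f.app n (X.d i x) = Y.d i (f.app (n + 1) x) :=
  f.naturality _ x

end SimplicialMap

/-- The simplicial space `X_p = X^{[p+1]}` associated to `π : X → M`: faces omit and degeneracies
repeat factors. -/
def cech {X M : Type u} [DiffeologicalSpace X] (π : X → M) : SimplicialSpace.{u} where
  obj p := FibrePower π p
  map θ x := ⟨x.1 ∘ θ, fun i j => x.2 (θ i) (θ j)⟩
  map_id _ := rfl
  map_comp _ _ _ := rfl

section NG

variable {G : Type u} [Group G]

/-- The simplicial operators of `NG`: for `θ` monotone, the `i`-th entry of `θ^* (g₁, …, gₙ)` is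
the product of the `g_j` with `θ(i-1) < j ≤ θ(i)`, written as a quotient of partial products. -/
def nerveMap {m n : ℕ} (θ : Fin (m + 1) →o Fin (n + 1)) (g : Fin n → G) : Fin m → G :=
  fun i => (Fin.partialProd g (θ i.castSucc))⁻¹ * Fin.partialProd g (θ i.succ)

theorem partialProd_nerveMap {m n : ℕ} (θ : Fin (m + 1) →o Fin (n + 1)) (g : Fin n → G)
    (k : Fin (m + 1)) : Fin.partialProd (nerveMap θ g) k =
      (Fin.partialProd g (θ 0))⁻¹ * Fin.partialProd g (θ k) := by
  induction k using Fin.induction with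
  | zero => simp
  | succ k ih => rw [Fin.partialProd_succ, ih]; simp [nerveMap, mul_assoc]

/-- The first face of `NG` is `d₀(g₁, …, gₙ₊₁) = (g₂, …, gₙ₊₁)`. -/
theorem nerveMap_face_zero {n : ℕ} (g : Fin (n + 1) → G) :
    nerveMap (Fin.succAboveOrderEmb (0 : Fin (n + 2))).toOrderHom g = Fin.tail g := by
  funext k
  have h := Fin.partialProd_right_inv g k.succ
  simpa [nerveMap, Fin.tail] using h

/-- The other faces of `NG` are `d_j(g₁, …, gₙ₊₁) = (g₁, …, g_j g_{j+1}, …, gₙ₊₁)` for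
`1 ≤ j ≤ n` and `d_{n+1}(g₁, …, gₙ₊₁) = (g₁, …, gₙ)`. -/
theorem nerveMap_face_succ {n : ℕ} (j : Fin (n + 1)) (g : Fin (n + 1) → G) :
    nerveMap (Fin.succAboveOrderEmb j.succ).toOrderHom g = j.contractNth (· * ·) g := by
  funext k
  have h := Fin.inv_partialProd_mul_eq_contractNth g j k
  rw [← Fin.succ_succAbove_succ] at h
  exact h

variable (G) in
/-- The simplicial space `NG` with `NG_n = G^n`. -/
def nerve [DiffeologicalSpace G] : SimplicialSpace.{u} where
  obj n := Fin n → G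
  map θ g := nerveMap θ g
  map_id g := by
    funext i
    simp [nerveMap, Fin.partialProd_right_inv]
  map_comp θ η g := by
    funext i
    show nerveMap (θ.comp η) g i = nerveMap η (nerveMap θ g) i
    rw [nerveMap, nerveMap, partialProd_nerveMap, partialProd_nerveMap]
    simp [mul_assoc]

end NG

section tau

variable {G P M : Type u} [Group G] [DiffeologicalSpace G] [DiffeologicalSpace P]
  [DiffeologicalSpace M] {π : P → M} {ρ : P → G → P}

/-- The maps `τ : P^{[n+1]} → G^n`, `(p₁, …, pₙ₊₁) ↦ (τ(p₁, p₂), …, τ(pₙ, pₙ₊₁))`, where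
`p_{i+1} = p_i · τ(p_i, p_{i+1})`. -/
noncomputable def tauFun (h : IsPrincipalBundle π ρ) (n : ℕ) (x : FibrePower π n) : Fin n → G :=
  fun i => h.div (x.2 i.castSucc i.succ)

theorem act_partialProd_tauFun (h : IsPrincipalBundle π ρ) {n : ℕ} (x : FibrePower π n)
    (k : Fin (n + 1)) : ρ (x.1 0) (Fin.partialProd (tauFun h n x) k) = x.1 k := by
  induction k using Fin.induction with
  | zero => simp [h.act_one]
  | succ k ih => rw [Fin.partialProd_succ, h.act_mul, ih]; exact h.act_div _

theorem tauFun_nerveMap (h : IsPrincipalBundle π ρ) {m n : ℕ} (x : FibrePower π n)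
    (θ : Fin (m + 1) →o Fin (n + 1)) (i : Fin m) :
    nerveMap θ (tauFun h n x) i = h.div (x.2 (θ i.castSucc) (θ i.succ)) := by
  refine h.div_unique _ ?_
  have h1 := act_partialProd_tauFun h x (θ i.castSucc)
  have h2 := act_partialProd_tauFun h x (θ i.succ)
  rw [nerveMap, ← h1, ← h.act_mul, mul_inv_cancel_left, h2]

/-- The simplicial map `τ : P^{[• + 1]} → NG` of a principal `G`-bundle. -/
noncomputable def tau (h : IsPrincipalBundle π ρ) : SimplicialMap (cech π) (nerve G) where
  app n := tauFun h n
  naturality θ x := by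
    funext i
    exact (tauFun_nerveMap h x θ i).symm

end tau

/-! ### Bundle gerbes -/

/-- The data underlying a bundle gerbe `(Q, Y, N)`, without the axioms of
`BundleGerbeData.IsBundleGerbe`. The map `Q → Y^{[2]}` is `u ↦ (src u, tgt u)`, so that the fibre
`Q_{(y₁, y₂)}` consists of the `u` with `src u = y₁` and `tgt u = y₂`. -/
structure BundleGerbeData (N : Type u) where
  /-- the space over `N` -/
  Y : Type u
  /-- the total space of the `ℂˣ`-bundle over `Y^{[2]}` -/
  Q : Type u
  [diffeologyY : DiffeologicalSpace Y]
  [diffeologyQ : DiffeologicalSpace Q]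
  /-- the projection `Y → N` -/
  proj : Y → N
  /-- the first component of `Q → Y^{[2]}` -/
  src : Q → Y
  /-- the second component of `Q → Y^{[2]}` -/
  tgt : Q → Y
  proj_tgt : ∀ q, proj (tgt q) = proj (src q)
  /-- the action of `ℂˣ` -/
  act : Q → ℂˣ → Q
  src_act : ∀ q z, src (act q z) = src q
  tgt_act : ∀ q z, tgt (act q z) = tgt q
  /-- the product `(u₂₃, u₁₂) ↦ u₂₃ u₁₂` of `u₂₃ ∈ Q_{(y₂, y₃)}` and `u₁₂ ∈ Q_{(y₁, y₂)}` -/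
  mul : {w : Q × Q // src w.1 = tgt w.2} → Q
  src_mul : ∀ w, src (mul w) = src w.1.2
  tgt_mul : ∀ w, tgt (mul w) = tgt w.1.1

attribute [instance] BundleGerbeData.diffeologyY BundleGerbeData.diffeologyQ

namespace BundleGerbeData

variable {N : Type u} (D : BundleGerbeData N)

/-- The fibre product `Y^{[2]}`. -/
abbrev YSq : Type u := {y : D.Y × D.Y // D.proj y.2 = D.proj y.1}

/-- The projection `Q → Y^{[2]}`. -/
def toYSq (q : D.Q) : D.YSq := ⟨(D.src q, D.tgt q), D.proj_tgt q⟩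

/-- A bundle gerbe: `Y → N` is a surjection admitting local sections, `Q → Y^{[2]}` is a principal
`ℂˣ`-bundle, and the product is a morphism `π₁⁻¹Q ⊗ π₃⁻¹Q → π₂⁻¹Q` of `ℂˣ`-bundles over `Y^{[3]}`
(a morphism out of the contracted product is a smooth map on pairs that is equivariant in each
variable) which is associative. -/
structure IsBundleGerbe [DiffeologicalSpace N] : Prop where
  locallySplit : IsLocallySplit D.proj
  manifold : IsSmoothManifold D.Q
  principal : IsPrincipalBundle D.toYSq D.act
  smooth_mul : DSmooth D.mul
  mul_act : ∀ (u v : D.Q) (h : D.src u = D.tgt v) (z w : ℂˣ),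
    D.mul ⟨(D.act u z, D.act v w), (D.src_act u z).trans (h.trans (D.tgt_act v w).symm)⟩ = D.act (D.mul ⟨(u, v), h⟩) (z * w)
  mul_assoc : ∀ (u v w : D.Q) (h : D.src u = D.tgt v) (h' : D.src v = D.tgt w),
    D.mul ⟨(u, D.mul ⟨(v, w), h'⟩), h.trans (D.tgt_mul ⟨(v, w), h'⟩).symm⟩ =
      D.mul ⟨(D.mul ⟨(u, v), h⟩, w), (D.src_mul ⟨(u, v), h⟩).trans h'⟩

/-- `e ∈ Q_{(y, y)}` is an identity for the product. -/
structure IsIdentity (e : D.Q) (y : D.Y) : Prop where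
  src_eq : D.src e = y
  tgt_eq : D.tgt e = y
  mul_right : ∀ (u : D.Q) (h : D.src u = D.tgt e), D.mul ⟨(u, e), h⟩ = u
  mul_left : ∀ (u : D.Q) (h : D.src e = D.tgt u), D.mul ⟨(e, u), h⟩ = u

variable {D} [DiffeologicalSpace N]

theorem IsBundleGerbe.existsUnique_identity (hD : D.IsBundleGerbe) (y : D.Y) :
    ∃! e : D.Q, D.IsIdentity e y := by
  have htors : ∀ {u v : D.Q}, D.src u = D.src v → D.tgt u = D.tgt v →
      ∃! z : ℂˣ, D.act u z = v := fun h h' =>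
    hD.principal.existsUnique_act (Subtype.ext (Prod.ext h h'))
  have hsrc := D.src_act
  have htgt := D.tgt_act
  have hone : ∀ u z, D.act u z = u → z = 1 := fun u z h =>
    (htors rfl rfl).unique h (hD.principal.act_one u)
  obtain ⟨u, hu⟩ := hD.principal.surjective ⟨(y, y), rfl⟩
  have hus : D.src u = y := congrArg (fun p => p.1.1) hu
  have hut : D.tgt u = y := congrArg (fun p => p.1.2) hu
  have huu : D.src u = D.tgt u := hus.trans hut.symm
  obtain ⟨c, hc, -⟩ := htors (u := u) (v := D.mul ⟨(u, u), huu⟩)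
    (D.src_mul ⟨(u, u), huu⟩).symm (D.tgt_mul ⟨(u, u), huu⟩).symm
  obtain ⟨e, he⟩ : ∃ e, e = D.act u c⁻¹ := ⟨_, rfl⟩
  have hes : D.src e = y := by rw [he, hsrc, hus]
  have het : D.tgt e = y := by rw [he, htgt, hut]
  have hee : ∀ h, D.mul ⟨(e, e), h⟩ = e := by
    subst he
    intro h
    rw [hD.mul_act u u huu, ← hc, ← hD.principal.act_mul]
    congr 1
    simp
  have hid : D.IsIdentity e y := by
    refine ⟨hes, het, fun v h => ?_, fun v h => ?_⟩
    · obtain ⟨z, hz, -⟩ := htors (u := v) (v := D.mul ⟨(v, e), h⟩)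
        (by rw [D.src_mul]; exact h.trans (het.trans hes.symm)) (D.tgt_mul ⟨(v, e), h⟩).symm
      have h1 := hD.mul_assoc v e e h (hes.trans het.symm)
      simp only [hee] at h1
      have h2 : D.mul ⟨(D.act v z, D.act e 1), by rw [hsrc, htgt]; exact h⟩ =
          D.act (D.mul ⟨(v, e), h⟩) z := by
        rw [hD.mul_act v e h, mul_one]
      simp only [hD.principal.act_one, hz] at h2
      rw [← h1] at h2
      have := hone _ _ h2.symm
      rw [← hz, this, hD.principal.act_one]
    · obtain ⟨z, hz, -⟩ := htors (u := v) (v := D.mul ⟨(e, v), h⟩)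
        (D.src_mul ⟨(e, v), h⟩).symm
        (by rw [D.tgt_mul]; exact h.symm.trans (hes.trans het.symm))
      have h1 := hD.mul_assoc e e v (hes.trans het.symm) h
      simp only [hee] at h1
      have h2 : D.mul ⟨(D.act e 1, D.act v z), by rw [hsrc, htgt]; exact h⟩ =
          D.act (D.mul ⟨(e, v), h⟩) z := by
        rw [hD.mul_act e v h, one_mul]
      simp only [hD.principal.act_one, hz] at h2
      rw [h1] at h2
      have := hone _ _ h2.symm
      rw [← hz, this, hD.principal.act_one]
  refine ⟨e, hid, fun e' he' => ?_⟩
  have h1 := he'.mul_left e (he'.src_eq.trans het.symm)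
  have h2 := hid.mul_right e' (he'.src_eq.trans het.symm)
  exact h2.symm.trans h1

/-- The identity section of a bundle gerbe over the diagonal. -/
noncomputable def IsBundleGerbe.one (hD : D.IsBundleGerbe) (y : D.Y) : D.Q :=
  (hD.existsUnique_identity y).choose

theorem IsBundleGerbe.isIdentity_one (hD : D.IsBundleGerbe) (y : D.Y) :
    D.IsIdentity (hD.one y) y :=
  (hD.existsUnique_identity y).choose_spec.1

end BundleGerbeData

/-! ### Simplicial bundle gerbes -/

/-- The fibre product `Y ∘ Y = d₀⁻¹Y ×_{X₂} d₂⁻¹Y`, with points `(x, y₂₃, y₁₂)`. -/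
abbrev BundleGerbeData.Y2 {X : SimplicialSpace.{u}} (D : BundleGerbeData (X.obj 1)) : Type u :=
  {p : X.obj 2 × D.Y × D.Y // D.proj p.2.1 = X.d 0 p.1 ∧ D.proj p.2.2 = X.d 2 p.1}

/-- Pairs `(u₂₃, u₁₂)` representing the elements of `Q ∘ Q = d₀⁻¹Q ⊗ d₂⁻¹Q`. -/
abbrev BundleGerbeData.Q2 {X : SimplicialSpace.{u}} (D : BundleGerbeData (X.obj 1)) : Type u :=
  {p : X.obj 2 × D.Q × D.Q //
    D.proj (D.src p.2.1) = X.d 0 p.1 ∧ D.proj (D.src p.2.2) = X.d 2 p.1}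

/-- The fibre product `Y ∘ Y ∘ Y` over `X₃`, with points `(x, y₃₄, y₂₃, y₁₂)`. -/
abbrev BundleGerbeData.Y3 {X : SimplicialSpace.{u}} (D : BundleGerbeData (X.obj 1)) : Type u :=
  {p : X.obj 3 × D.Y × D.Y × D.Y // D.proj p.2.1 = X.d 0 (X.d 0 p.1) ∧
    D.proj p.2.2.1 = X.d 2 (X.d 0 p.1) ∧ D.proj p.2.2.2 = X.d 2 (X.d 2 p.1)}

/-- Triples `(u₃₄, u₂₃, u₁₂)` representing the elements of `Q ∘ Q ∘ Q` over `X₃`. -/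
abbrev BundleGerbeData.Q3 {X : SimplicialSpace.{u}} (D : BundleGerbeData (X.obj 1)) : Type u :=
  {p : X.obj 3 × D.Q × D.Q × D.Q // D.proj (D.src p.2.1) = X.d 0 (X.d 0 p.1) ∧
    D.proj (D.src p.2.2.1) = X.d 2 (X.d 0 p.1) ∧ D.proj (D.src p.2.2.2) = X.d 2 (X.d 2 p.1)}

/-- The fibre product `Y ∘ Y ∘ Y ∘ Y` over `X₄`, with points `(x, y₄₅, y₃₄, y₂₃, y₁₂)`. -/
abbrev BundleGerbeData.Y4 {X : SimplicialSpace.{u}} (D : BundleGerbeData (X.obj 1)) : Type u :=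
  {p : X.obj 4 × D.Y × D.Y × D.Y × D.Y // D.proj p.2.1 = X.d 0 (X.d 0 (X.d 0 p.1)) ∧
    D.proj p.2.2.1 = X.d 2 (X.d 0 (X.d 0 p.1)) ∧ D.proj p.2.2.2.1 = X.d 2 (X.d 2 (X.d 0 p.1)) ∧
    D.proj p.2.2.2.2 = X.d 2 (X.d 2 (X.d 2 p.1))}

namespace BundleGerbeData

variable {X : SimplicialSpace.{u}} (D : BundleGerbeData (X.obj 1))

/-- The map `Q ∘ Q → Y ∘ Y` given by the first components. -/
def src2 (q : D.Q2) : D.Y2 := ⟨(q.1.1, D.src q.1.2.1, D.src q.1.2.2), q.2⟩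

/-- The map `Q ∘ Q → Y ∘ Y` given by the second components. -/
def tgt2 (q : D.Q2) : D.Y2 :=
  ⟨(q.1.1, D.tgt q.1.2.1, D.tgt q.1.2.2), by simpa only [D.proj_tgt] using q.2⟩

/-- The map `Q ∘ Q ∘ Q → Y ∘ Y ∘ Y` given by the first components. -/
def src3 (q : D.Q3) : D.Y3 :=
  ⟨(q.1.1, D.src q.1.2.1, D.src q.1.2.2.1, D.src q.1.2.2.2), q.2⟩

/-- The map `Q ∘ Q ∘ Q → Y ∘ Y ∘ Y` given by the second components. -/
def tgt3 (q : D.Q3) : D.Y3 :=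
  ⟨(q.1.1, D.tgt q.1.2.1, D.tgt q.1.2.2.1, D.tgt q.1.2.2.2), by
    simpa only [D.proj_tgt] using q.2⟩

end BundleGerbeData

/-- A bundle gerbe on `X₁` together with the maps `m : Y ∘ Y → Y` and `m̂ : Q ∘ Q → Q` of a bundle
gerbe morphism `d₀⁻¹Q ⊗ d₂⁻¹Q → d₁⁻¹Q` over `X₂` (data only, without the axioms). -/
structure MultiplicativeData (X : SimplicialSpace.{u}) extends BundleGerbeData (X.obj 1) where
  /-- the map `m(y₂₃, y₁₂)` -/
  m : toBundleGerbeData.Y2 → Y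
  proj_m : ∀ p, proj (m p) = X.d 1 p.1.1
  /-- the map `m̂(u₂₃ ⊗ u₁₂)`, covering `m^{[2]}` -/
  mhat : toBundleGerbeData.Q2 → Q
  src_mhat : ∀ q, src (mhat q) = m (toBundleGerbeData.src2 q)
  tgt_mhat : ∀ q, tgt (mhat q) = m (toBundleGerbeData.tgt2 q)

namespace MultiplicativeData

variable {X : SimplicialSpace.{u}} (D : MultiplicativeData X)

theorem proj_src_mhat (q : D.Q2) : D.proj (D.src (D.mhat q)) = X.d 1 q.1.1 := by
  rw [D.src_mhat, D.proj_m]; rfl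

/-- `m₁(y₃₄, y₂₃, y₁₂) = m(m(y₃₄, y₂₃), y₁₂)`. -/
def m1 (p : D.Y3) : D.Y :=
  D.m ⟨(X.d 2 p.1.1, D.m ⟨(X.d 0 p.1.1, p.1.2.1, p.1.2.2.1), p.2.1, p.2.2.1⟩, p.1.2.2.2),
    (D.proj_m _).trans (X.d_d (i := 0) (j := 1) (by decide) p.1.1).symm, p.2.2.2⟩

/-- `m₂(y₃₄, y₂₃, y₁₂) = m(y₃₄, m(y₂₃, y₁₂))`. -/
def m2 (p : D.Y3) : D.Y :=
  D.m ⟨(X.d 1 p.1.1, p.1.2.1, D.m ⟨(X.d 3 p.1.1, p.1.2.2.1, p.1.2.2.2),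
      p.2.2.1.trans (X.d_d (i := 0) (j := 2) (by decide) p.1.1).symm,
      p.2.2.2.trans (X.d_d (i := 2) (j := 2) (by decide) p.1.1).symm⟩),
    p.2.1.trans (X.d_d (i := 0) (j := 0) (by decide) p.1.1).symm,
    (D.proj_m _).trans (X.d_d (i := 1) (j := 2) (by decide) p.1.1)⟩

/-- `m̂₁(u₃₄ ⊗ u₂₃ ⊗ u₁₂) = m̂(m̂(u₃₄ ⊗ u₂₃) ⊗ u₁₂)`. -/
def mhat1 (q : D.Q3) : D.Q :=
  D.mhat ⟨(X.d 2 q.1.1, D.mhat ⟨(X.d 0 q.1.1, q.1.2.1, q.1.2.2.1), q.2.1, q.2.2.1⟩, q.1.2.2.2),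
    (D.proj_src_mhat _).trans (X.d_d (i := 0) (j := 1) (by decide) q.1.1).symm, q.2.2.2⟩

/-- `m̂₂(u₃₄ ⊗ u₂₃ ⊗ u₁₂) = m̂(u₃₄ ⊗ m̂(u₂₃ ⊗ u₁₂))`. -/
def mhat2 (q : D.Q3) : D.Q :=
  D.mhat ⟨(X.d 1 q.1.1, q.1.2.1, D.mhat ⟨(X.d 3 q.1.1, q.1.2.2.1, q.1.2.2.2),
      q.2.2.1.trans (X.d_d (i := 0) (j := 2) (by decide) q.1.1).symm,
      q.2.2.2.trans (X.d_d (i := 2) (j := 2) (by decide) q.1.1).symm⟩),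
    q.2.1.trans (X.d_d (i := 0) (j := 0) (by decide) q.1.1).symm,
    (D.proj_src_mhat _).trans (X.d_d (i := 1) (j := 2) (by decide) q.1.1)⟩

theorem src_mhat1 (q : D.Q3) : D.src (D.mhat1 q) = D.m1 (D.src3 q) := by
  unfold mhat1 m1
  rw [D.src_mhat]
  congr 1
  simp only [BundleGerbeData.src2, BundleGerbeData.src3, D.src_mhat]

theorem tgt_mhat1 (q : D.Q3) : D.tgt (D.mhat1 q) = D.m1 (D.tgt3 q) := by
  unfold mhat1 m1
  rw [D.tgt_mhat]
  congr 1
  simp only [BundleGerbeData.tgt2, BundleGerbeData.tgt3, D.tgt_mhat]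

theorem src_mhat2 (q : D.Q3) : D.src (D.mhat2 q) = D.m2 (D.src3 q) := by
  unfold mhat2 m2
  rw [D.src_mhat]
  congr 1
  simp only [BundleGerbeData.src2, BundleGerbeData.src3, D.src_mhat]

theorem tgt_mhat2 (q : D.Q3) : D.tgt (D.mhat2 q) = D.m2 (D.tgt3 q) := by
  unfold mhat2 m2
  rw [D.tgt_mhat]
  congr 1
  simp only [BundleGerbeData.tgt2, BundleGerbeData.tgt3, D.tgt_mhat]

/-- The maps `(m, m̂)` form a morphism of bundle gerbes `d₀⁻¹Q ⊗ d₂⁻¹Q → d₁⁻¹Q` over `X₂`: they are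
smooth, `m̂` is a morphism of `ℂˣ`-bundles covering `m^{[2]}`, and `m̂` preserves the bundle gerbe
products. -/
structure IsMorphism : Prop where
  smooth_m : DSmooth D.m
  smooth_mhat : DSmooth D.mhat
  mhat_act : ∀ (q q' : D.Q2) (z w : ℂˣ), q'.1 = (q.1.1, D.act q.1.2.1 z, D.act q.1.2.2 w) →
    D.mhat q' = D.act (D.mhat q) (z * w)
  mhat_mul : ∀ (q q' : D.Q2) (h : D.src2 q = D.tgt2 q') (h₁ : D.src q.1.2.1 = D.tgt q'.1.2.1)
    (h₂ : D.src q.1.2.2 = D.tgt q'.1.2.2) (q'' : D.Q2),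
    q''.1 = (q.1.1, D.mul ⟨(q.1.2.1, q'.1.2.1), h₁⟩, D.mul ⟨(q.1.2.2, q'.1.2.2), h₂⟩) →
    D.mhat q'' = D.mul ⟨(D.mhat q, D.mhat q'), by rw [D.src_mhat, D.tgt_mhat, h]⟩

end MultiplicativeData

/-- The data of a simplicial bundle gerbe on `X`, without the axioms: in addition to the maps `m`
and `m̂`, a section `â` of `(m₁, m₂)⁻¹Q` over `Y ∘ Y ∘ Y`. -/
structure SimplicialBundleGerbeData (X : SimplicialSpace.{u}) extends MultiplicativeData X where
  /-- the associator section -/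
  a : toBundleGerbeData.Y3 → Q
  src_a : ∀ p, src (a p) = toMultiplicativeData.m1 p
  tgt_a : ∀ p, tgt (a p) = toMultiplicativeData.m2 p

namespace SimplicialBundleGerbeData

variable {X : SimplicialSpace.{u}} (D : SimplicialBundleGerbeData X)

/-- `â` defines a transformation `m₁ ⇒ m₂` of bundle gerbe morphisms over `X₃`: it is a smooth
section of `(m₁, m₂)⁻¹Q` that is compatible with the descent isomorphism
`v ↦ m̂₂(u) (v m̂₁(u)⁻¹)`, i.e. descends to a section of `D_{m₁, m₂}` over `X₃`. -/
structure IsTransformation : Prop where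
  smooth_a : DSmooth D.a
  compatible : ∀ q : D.Q3,
    D.mul ⟨(D.a (D.tgt3 q), D.mhat1 q), by rw [D.src_a, D.tgt_mhat1]⟩ =
      D.mul ⟨(D.mhat2 q, D.a (D.src3 q)), by rw [D.tgt_a, D.src_mhat2]⟩

/-- `(y₄₅, y₃₄, y₂₃)` over `d₀ x`. -/
def pt0 (p : D.Y4) : D.Y3 :=
  ⟨(X.d 0 p.1.1, p.1.2.1, p.1.2.2.1, p.1.2.2.2.1), p.2.1, p.2.2.1, p.2.2.2.1⟩

/-- `(y₄₅, y₃₄, m(y₂₃, y₁₂))` over `d₁ x`. -/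
def pt1 (p : D.Y4) : D.Y3 :=
  ⟨(X.d 1 p.1.1, p.1.2.1, p.1.2.2.1,
    D.m ⟨(X.d 3 (X.d 4 p.1.1), p.1.2.2.2.1, p.1.2.2.2.2), by
      obtain ⟨⟨x, y₄₅, y₃₄, y₂₃, y₁₂⟩, h⟩ := p
      simp only at h ⊢
      simp only [h, X.d_d_two, X.d_d_three, and_self]⟩), by
    obtain ⟨⟨x, y₄₅, y₃₄, y₂₃, y₁₂⟩, h⟩ := p
    simp only at h ⊢
    simp only [h, D.proj_m, X.d_d_two, X.d_d_three, and_self]⟩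

/-- `(y₄₅, m(y₃₄, y₂₃), y₁₂)` over `d₂ x`. -/
def pt2 (p : D.Y4) : D.Y3 :=
  ⟨(X.d 2 p.1.1, p.1.2.1,
    D.m ⟨(X.d 3 (X.d 0 p.1.1), p.1.2.2.1, p.1.2.2.2.1), by
      obtain ⟨⟨x, y₄₅, y₃₄, y₂₃, y₁₂⟩, h⟩ := p
      simp only at h ⊢
      simp only [h, X.d_d_two, and_self]⟩, p.1.2.2.2.2), by
    obtain ⟨⟨x, y₄₅, y₃₄, y₂₃, y₁₂⟩, h⟩ := p
    simp only at h ⊢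
    simp only [h, D.proj_m, X.d_d_two, X.d_d_three, and_self]⟩

/-- `(m(y₄₅, y₃₄), y₂₃, y₁₂)` over `d₃ x`. -/
def pt3 (p : D.Y4) : D.Y3 :=
  ⟨(X.d 3 p.1.1, D.m ⟨(X.d 0 (X.d 0 p.1.1), p.1.2.1, p.1.2.2.1), p.2.1, p.2.2.1⟩,
    p.1.2.2.2.1, p.1.2.2.2.2), by
    obtain ⟨⟨x, y₄₅, y₃₄, y₂₃, y₁₂⟩, h⟩ := p
    simp only at h ⊢
    simp only [h, D.proj_m, X.d_d_two, X.d_d_three, and_self]⟩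

/-- `(y₃₄, y₂₃, y₁₂)` over `d₄ x`. -/
def pt4 (p : D.Y4) : D.Y3 :=
  ⟨(X.d 4 p.1.1, p.1.2.2.1, p.1.2.2.2.1, p.1.2.2.2.2), by
    obtain ⟨⟨x, y₄₅, y₃₄, y₂₃, y₁₂⟩, h⟩ := p
    simp only at h ⊢
    simp only [h, X.d_d_two, X.d_d_three, and_self]⟩

theorem proj_src_a (p : D.Y3) : D.proj (D.src (D.a p)) = X.d 1 (X.d 2 p.1.1) := by
  rw [D.src_a, MultiplicativeData.m1, D.proj_m]

/-- The element `m̂(â(y₄₅, y₃₄, y₂₃) ⊗ e)`, with `e` in the fibre of `Q` over `(y₁₂, y₁₂)`. -/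
def aWhiskerRight (p : D.Y4) (e : D.Q) (he : D.src e = p.1.2.2.2.2) : D.Q :=
  D.mhat ⟨(X.d 2 (X.d 2 p.1.1), D.a (D.pt0 p), e), by
    simp only [D.proj_src_a, he, p.2.2.2.2, pt0, X.d_d_two, X.d_d_three, and_self]⟩

/-- The element `m̂(e ⊗ â(y₃₄, y₂₃, y₁₂))`, with `e` in the fibre of `Q` over `(y₄₅, y₄₅)`. -/
def aWhiskerLeft (p : D.Y4) (e : D.Q) (he : D.src e = p.1.2.1) : D.Q :=
  D.mhat ⟨(X.d 1 (X.d 1 p.1.1), e, D.a (D.pt4 p)), by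
    simp only [D.proj_src_a, he, p.2.1, pt4, X.d_d_two, X.d_d_three, and_self]⟩

theorem m_congr {p q : D.Y2} (h : p.1 = q.1) : D.m p = D.m q := congrArg D.m (Subtype.ext h)

theorem tgt_aWhiskerRight (p : D.Y4) (e : D.Q) (he : D.src e = p.1.2.2.2.2)
    (he' : D.tgt e = p.1.2.2.2.2) : D.tgt (D.aWhiskerRight p e he) = D.src (D.a (D.pt2 p)) := by
  unfold aWhiskerRight
  rw [D.tgt_mhat, D.src_a]
  refine D.m_congr ?_
  simp only [BundleGerbeData.tgt2, D.tgt_a, he', pt0, pt2, Prod.mk.injEq, and_true, true_and]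
  refine D.m_congr ?_
  simp only [X.d_d_three]

theorem tgt_a_pt2 (p : D.Y4) (e : D.Q) (he : D.src e = p.1.2.1) :
    D.tgt (D.a (D.pt2 p)) = D.src (D.aWhiskerLeft p e he) := by
  unfold aWhiskerLeft
  rw [D.src_mhat, D.tgt_a]
  refine D.m_congr ?_
  simp only [BundleGerbeData.src2, D.src_a, he, pt4, pt2, Prod.mk.injEq, X.d_d_three, true_and]
  refine D.m_congr ?_
  simp only [X.d_d_three]

theorem tgt_a_pt3 (p : D.Y4) : D.tgt (D.a (D.pt3 p)) = D.src (D.a (D.pt1 p)) := by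
  rw [D.tgt_a, D.src_a]
  refine D.m_congr ?_
  simp only [pt1, pt3, X.d_d_three]

/-- The composite `(1 ∘ d₄⁻¹a) (d₂⁻¹a) (d₀⁻¹a ∘ 1)` at a point of `Y ∘ Y ∘ Y ∘ Y`, where `e` and
`e'` are the identities at `y₄₅` and `y₁₂`. -/
def pentagonLeft (p : D.Y4) (e e' : D.Q) (he : D.IsIdentity e p.1.2.1)
    (he' : D.IsIdentity e' p.1.2.2.2.2) : D.Q :=
  D.mul ⟨(D.aWhiskerLeft p e he.src_eq,
      D.mul ⟨(D.a (D.pt2 p), D.aWhiskerRight p e' he'.src_eq),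
        (D.tgt_aWhiskerRight p e' he'.src_eq he'.tgt_eq).symm⟩), by
    rw [D.tgt_mul, ← D.tgt_a_pt2 p e he.src_eq]⟩

/-- The composite `(d₁⁻¹a) (d₃⁻¹a)` at a point of `Y ∘ Y ∘ Y ∘ Y`. -/
def pentagonRight (p : D.Y4) : D.Q :=
  D.mul ⟨(D.a (D.pt1 p), D.a (D.pt3 p)), (D.tgt_a_pt3 p).symm⟩

/-- The axioms of a simplicial bundle gerbe. The coherency condition
`d₀⁻¹a ⊗ d₁⁻¹a* ⊗ d₂⁻¹a ⊗ d₃⁻¹a* ⊗ d₄⁻¹a = 1` over `X₄` is the equality of the two composite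
transformations from `((y₄₅ y₃₄) y₂₃) y₁₂` to `y₄₅ (y₃₄ (y₂₃ y₁₂))`. -/
structure IsSimplicialBundleGerbe : Prop where
  isBundleGerbe : D.IsBundleGerbe
  isMorphism : D.IsMorphism
  isTransformation : D.IsTransformation
  coherency : ∀ p : D.Y4,
    D.pentagonLeft p (isBundleGerbe.one p.1.2.1) (isBundleGerbe.one p.1.2.2.2.2)
      (isBundleGerbe.isIdentity_one _) (isBundleGerbe.isIdentity_one _) = D.pentagonRight p

end SimplicialBundleGerbeData

/-! ### Pullbacks -/

/-- The pullback `(f⁻¹Q, f⁻¹Y, N')` of a bundle gerbe `(Q, Y, N)` along `f : N' → N`: here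
`f⁻¹Y = N' ×_N Y`, and `f⁻¹Q` is the pullback of `Q` to `(f⁻¹Y)^{[2]}`. -/
def BundleGerbeData.pullback {N N' : Type u} [DiffeologicalSpace N'] (D : BundleGerbeData N)
    (f : N' → N) : BundleGerbeData N' where
  Y := {p : N' × D.Y // D.proj p.2 = f p.1}
  Q := {p : N' × D.Q // D.proj (D.src p.2) = f p.1}
  proj p := p.1.1
  src q := ⟨(q.1.1, D.src q.1.2), q.2⟩
  tgt q := ⟨(q.1.1, D.tgt q.1.2), (D.proj_tgt _).trans q.2⟩
  proj_tgt _ := rfl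
  act q z := ⟨(q.1.1, D.act q.1.2 z), by rw [D.src_act]; exact q.2⟩
  src_act q z := Subtype.ext (Prod.ext rfl (D.src_act q.1.2 z))
  tgt_act q z := Subtype.ext (Prod.ext rfl (D.tgt_act q.1.2 z))
  mul w := ⟨(w.1.2.1.1, D.mul ⟨(w.1.1.1.2, w.1.2.1.2),
    congrArg (fun y => y.1.2) w.2⟩), by rw [D.src_mul]; exact w.1.2.2⟩
  src_mul w := Subtype.ext (Prod.ext rfl (D.src_mul _))
  tgt_mul w := Subtype.ext (Prod.ext (congrArg (fun y => y.1.1) w.2).symm (D.tgt_mul _))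

section Pullback

variable {X X' : SimplicialSpace.{u}}

/-- The pullback of the bundle gerbe morphism `m` along a simplicial map `f : X' → X`. -/
def MultiplicativeData.pullback (D : MultiplicativeData X) (f : SimplicialMap X' X) :
    MultiplicativeData X' where
  toBundleGerbeData := D.toBundleGerbeData.pullback (f.app 1)
  m p := ⟨(X'.d 1 p.1.1, D.m ⟨(f.app 2 p.1.1, p.1.2.1.1.2, p.1.2.2.1.2),
      p.1.2.1.2.trans ((congrArg (f.app 1) p.2.1).trans (f.app_d 0 p.1.1)),
      p.1.2.2.2.trans ((congrArg (f.app 1) p.2.2).trans (f.app_d 2 p.1.1))⟩),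
    (D.proj_m _).trans (f.app_d 1 p.1.1).symm⟩
  proj_m _ := rfl
  mhat q := ⟨(X'.d 1 q.1.1, D.mhat ⟨(f.app 2 q.1.1, q.1.2.1.1.2, q.1.2.2.1.2),
      q.1.2.1.2.trans ((congrArg (f.app 1) q.2.1).trans (f.app_d 0 q.1.1)),
      q.1.2.2.2.trans ((congrArg (f.app 1) q.2.2).trans (f.app_d 2 q.1.1))⟩),
    (D.proj_src_mhat _).trans (f.app_d 1 q.1.1).symm⟩
  src_mhat _ := Subtype.ext (Prod.ext rfl (D.src_mhat _))
  tgt_mhat _ := Subtype.ext (Prod.ext rfl (D.tgt_mhat _))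

/-- The map `f⁻¹Y ∘ f⁻¹Y ∘ f⁻¹Y → Y ∘ Y ∘ Y`. -/
def MultiplicativeData.pullbackY3 (D : MultiplicativeData X) (f : SimplicialMap X' X)
    (p : (D.pullback f).Y3) : D.Y3 :=
  ⟨(f.app 3 p.1.1, p.1.2.1.1.2, p.1.2.2.1.1.2, p.1.2.2.2.1.2),
    p.1.2.1.2.trans ((congrArg (f.app 1) p.2.1).trans (by rw [f.app_d, f.app_d])),
    p.1.2.2.1.2.trans ((congrArg (f.app 1) p.2.2.1).trans (by rw [f.app_d, f.app_d])),
    p.1.2.2.2.2.trans ((congrArg (f.app 1) p.2.2.2).trans (by rw [f.app_d, f.app_d]))⟩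

theorem MultiplicativeData.m1_pullback (D : MultiplicativeData X) (f : SimplicialMap X' X)
    (p : (D.pullback f).Y3) :
    ((D.pullback f).m1 p).1 = (X'.d 1 (X'.d 2 p.1.1), D.m1 (D.pullbackY3 f p)) := by
  refine Prod.ext rfl (congrArg D.m (Subtype.ext (Prod.ext (f.app_d 2 p.1.1) (Prod.ext ?_ rfl))))
  exact congrArg D.m (Subtype.ext (Prod.ext (f.app_d 0 p.1.1) rfl))

theorem MultiplicativeData.m2_pullback (D : MultiplicativeData X) (f : SimplicialMap X' X)
    (p : (D.pullback f).Y3) :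
    ((D.pullback f).m2 p).1 = (X'.d 1 (X'.d 1 p.1.1), D.m2 (D.pullbackY3 f p)) := by
  refine Prod.ext rfl (congrArg D.m (Subtype.ext (Prod.ext (f.app_d 1 p.1.1) (Prod.ext rfl ?_))))
  exact congrArg D.m (Subtype.ext (Prod.ext (f.app_d 3 p.1.1) rfl))

/-- The pullback of a simplicial bundle gerbe along a simplicial map `f : X' → X`. -/
def SimplicialBundleGerbeData.pullback (D : SimplicialBundleGerbeData X)
    (f : SimplicialMap X' X) : SimplicialBundleGerbeData X' where
  toMultiplicativeData := D.toMultiplicativeData.pullback f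
  a p := ⟨(X'.d 1 (X'.d 2 p.1.1), D.a (D.pullbackY3 f p)), by
    rw [D.proj_src_a, f.app_d, f.app_d]; rfl⟩
  src_a p := Subtype.ext (by
    rw [D.m1_pullback f p]
    exact Prod.ext rfl (D.src_a (D.pullbackY3 f p)))
  tgt_a p := Subtype.ext (by
    rw [D.m2_pullback f p]
    exact Prod.ext (X'.d_d_two p.1.1).2.2.2.1 (D.tgt_a (D.pullbackY3 f p)))

end Pullback

/-! ### Bundle 2-gerbes -/

/-- `(Q, Y, X, M)` is a bundle 2-gerbe: `π : X → M` is a smooth surjection of manifolds admitting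
local sections, and `(Q, Y, X^{[2]})`, with its morphism `m` and associator `a`, is a simplicial
bundle gerbe on the simplicial manifold `X_p = X^{[p+1]}`. -/
structure IsBundleTwoGerbe {X M : Type u} [DiffeologicalSpace X] [DiffeologicalSpace M]
    (π : X → M) (D : SimplicialBundleGerbeData (cech π)) : Prop where
  manifold_base : IsSmoothManifold M
  manifold_total : IsSmoothManifold X
  locallySplit : IsLocallySplit π
  simplicialManifold : (cech π).IsSimplicialManifold
  manifold_Y : IsSmoothManifold D.Y
  manifold_Q : IsSmoothManifold D.Q
  simplicialBundleGerbe : D.IsSimplicialBundleGerbe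

end BundleGerbes

namespace BundleGerbes

/-! ### Smooth maps into and out of subspaces and products -/

section Basic

variable {X Y Z : Type*} [DiffeologicalSpace X] [DiffeologicalSpace Y] [DiffeologicalSpace Z]

/-! The argument separates an algebraic half, valid for every smooth simplicial map, from a
geometric half that uses the principal bundle.

Algebra: a point of a pulled-back space is a base point together with a point of the original space,
and all operations act on the second component by the original ones. Every axiom therefore splits
into an equation of base points, settled by naturality or a simplicial identity, and the original
axiom in `Q`. The coherency condition needs one extra remark: it mentions identity elements, and an
identity of the pullback projects to an identity of `Q` (`IsIdentity.of_pullback`), which is unique,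
so the original condition applies (`IsSimplicialBundleGerbe.pentagon`).

Geometry: a fibre product along an arbitrary smooth map need not be a manifold. Here it is, because
`(p, g) ↦ (p, p g₁, p g₁ g₂, …)` is a diffeomorphism `P × Gⁿ ≃ P^{[n+1]}` under which `τ` becomes
the second projection (`fibrePowerEquiv`, `tauFun_fibrePowerEquiv`). Hence `P^{[2]} ×_G Z ≅ P × Z`
for every smooth `Z → G` (`IsTrivialProjection.manifold_pullback`), which is applied to `Q` and to
the fibre powers of `Y`. The diffeomorphism also makes the fibre powers of `P` manifolds, once `P`
is known to be one from its local trivialisations. Its inverse is smooth because the division map is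
given by `(g, k) ↦ g⁻¹ k` in a trivialisation (`dSmooth_div`). -/

theorem dSmooth_subtype_val {p : X → Prop} : DSmooth (Subtype.val : Subtype p → X) :=
  fun _ _ h => h

@[fun_prop]
theorem dSmooth_val {p : Y → Prop} {f : X → Subtype p} (hf : DSmooth f) :
    DSmooth fun x => (f x).1 :=
  fun n q hq => hf n q hq

theorem dSmooth_of_val {p : Y → Prop} {f : X → Subtype p} (hf : DSmooth fun x => (f x).1) :
    DSmooth f :=
  fun n q hq => hf n q hq

@[fun_prop]
theorem dSmooth_subtype_mk {p : Y → Prop} {f : X → Y} (hf : DSmooth f) (h : ∀ x, p (f x)) :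
    DSmooth fun x => (⟨f x, h x⟩ : Subtype p) :=
  fun n q hq => hf n q hq

@[fun_prop]
theorem dSmooth_fst {f : X → Y × Z} (hf : DSmooth f) : DSmooth fun x => (f x).1 :=
  fun n q hq => (hf n q hq).1

@[fun_prop]
theorem dSmooth_snd {f : X → Y × Z} (hf : DSmooth f) : DSmooth fun x => (f x).2 :=
  fun n q hq => (hf n q hq).2

@[fun_prop]
theorem dSmooth_prodMk {f : X → Y} {g : X → Z} (hf : DSmooth f) (hg : DSmooth g) :
    DSmooth fun x => (f x, g x) :=
  fun n q hq => ⟨hf n q hq, hg n q hq⟩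

theorem dSmooth_pi {ι : Type*} {A : ι → Type*} [∀ i, DiffeologicalSpace (A i)]
    {f : X → ∀ i, A i} (hf : ∀ i, DSmooth fun x => f x i) : DSmooth f :=
  fun n q hq i => hf i n q hq

theorem dSmooth_apply {ι : Type*} {A : ι → Type*} [∀ i, DiffeologicalSpace (A i)]
    {f : X → ∀ i, A i} (hf : DSmooth f) (i : ι) : DSmooth fun x => f x i :=
  fun n q hq => hf n q hq i

theorem isOpen_preimage {f : X → Y} (hf : DSmooth f) {U : Set Y} (hU : IsOpen[dTopology] U) :
    IsOpen[dTopology] (f ⁻¹' U) :=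
  @Continuous.isOpen_preimage _ _ dTopology dTopology _ hf.continuous U hU

theorem isOpen_inter {U V : Set X} (hU : IsOpen[dTopology] U) (hV : IsOpen[dTopology] V) :
    IsOpen[dTopology] (U ∩ V) := by
  let _ : TopologicalSpace X := dTopology
  exact IsOpen.inter hU hV

/-- Smoothness is a local property. -/
theorem dSmooth_of_local {f : X → Y}
    (h : ∀ x : X, ∃ U : Set X, x ∈ U ∧ IsOpen[dTopology] U ∧ DSmooth fun t : U => f t) :
    DSmooth f := by
  intro n p hp
  refine DiffeologicalSpace.locality fun t => ?_
  obtain ⟨U, hxU, hU, hf⟩ := h (p t)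
  -- Reparametrisations landing in the open set `p ⁻¹' U` turn `p` into a plot of the subspace `U`,
  -- where `f` is known to be smooth.
  refine ⟨p ⁻¹' U, isOpen_iff_preimages_plots.1 hU n p hp, hxU, fun {m g} hg hgs => ?_⟩
  exact hf m (fun s => (⟨p (g s), hg s⟩ : U)) (isPlot_reparam hp hgs)

/-- An open subset of an open subspace is open. -/
theorem isOpen_image_val {U : Set X} (hU : IsOpen[dTopology] U) {W : Set U}
    (hW : IsOpen[dTopology] W) : IsOpen[dTopology] (Subtype.val '' W) := by
  refine isOpen_iff_preimages_plots.2 fun n p hp => isOpen_iff_mem_nhds.2 fun x hx => ?_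
  obtain ⟨w, hw, hwx⟩ := hx
  obtain ⟨ε, hε, hball⟩ := Metric.isOpen_iff.1 (isOpen_iff_preimages_plots.1 hU n p hp) x
    (show p x ∈ U from hwx ▸ w.2)
  -- Plots are defined on whole Euclidean spaces, so `p` cannot simply be restricted to the ball.
  -- Instead the ball is parametrised by the whole space, smoothly and with `0 ↦ x`, which gives a
  -- plot of `U`; openness of `W` there is carried back along `g`.
  let g := OpenPartialHomeomorph.univBall x ε
  have hg : ∀ s, p (g s) ∈ U := fun s => hball (by
    rw [← OpenPartialHomeomorph.univBall_target x hε]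
    exact g.map_source (by simp [g]))
  let q := fun s => (⟨p (g s), hg s⟩ : U)
  have hq : IsPlot q := isPlot_reparam hp OpenPartialHomeomorph.contDiff_univBall
  have hqW : IsOpen (q ⁻¹' W) := isOpen_iff_preimages_plots.1 hW n q hq
  have himg : IsOpen (g '' (q ⁻¹' W)) :=
    g.isOpen_image_of_subset_source hqW (by simp [g])
  refine Filter.mem_of_superset (himg.mem_nhds ⟨0, ?_, ?_⟩) ?_
  · have : q 0 = w := Subtype.ext (by simp [q, g, hwx])
    show q 0 ∈ W
    rwa [this]
  · simp [g]
  · rintro _ ⟨s, hs, rfl⟩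
    exact ⟨q s, hs, rfl⟩

theorem t2Space_of_injective {f : X → Y} (hf : DSmooth f) (hinj : Function.Injective f)
    (hY : @T2Space Y dTopology) : @T2Space X dTopology := by
  let _ : TopologicalSpace X := dTopology
  let _ : TopologicalSpace Y := dTopology
  exact T2Space.of_injective_continuous hinj hf.continuous

end Basic

/-! ### Products of convenient vector spaces -/

namespace ConvenientSpace

/-- The product of two convenient vector spaces. -/
def prod (E F : ConvenientSpace.{u}) : ConvenientSpace.{u} where
  carrier := E.carrier × F.carrier
  differentiable_of_scalarwise c hc t := by
    -- Functionals on a factor extend to the product through the projection, so each component of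
    -- `c` is again scalarwise smooth, and difference quotients converge componentwise.
    obtain ⟨v, hv⟩ := E.differentiable_of_scalarwise (fun t => (c t).1)
      (fun l => hc (l.comp (ContinuousLinearMap.fst ℝ E.carrier F.carrier))) t
    obtain ⟨w, hw⟩ := F.differentiable_of_scalarwise (fun t => (c t).2)
      (fun l => hc (l.comp (ContinuousLinearMap.snd ℝ E.carrier F.carrier))) t
    exact ⟨(v, w), hv.prodMk_nhds hw⟩

/-- The zero vector space. -/
def zero : ConvenientSpace.{u} where
  carrier := PUnit
  differentiable_of_scalarwise _ _ _ := ⟨0, tendsto_const_nhds⟩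

variable {E F : ConvenientSpace.{u}} {X : Type*} [DiffeologicalSpace X]

theorem dSmooth_iff {f : X → E.carrier} :
    DSmooth f ↔ ∀ (n : ℕ) (p : EuclideanSpace ℝ (Fin n) → X), IsPlot p →
      ∀ l : E.carrier →L[ℝ] ℝ, ContDiff ℝ ∞ fun t => l (f (p t)) :=
  Iff.rfl

/-- The plots of `E.prod F` are tested by functionals on the product, not component by component, so
the lemmas for the product diffeology do not apply directly. -/
theorem dSmooth_prod_fst : DSmooth fun v : (E.prod F).carrier => v.1 :=
  fun _ _ hp k => hp (k.comp (ContinuousLinearMap.fst ℝ E.carrier F.carrier))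

theorem dSmooth_prod_snd : DSmooth fun v : (E.prod F).carrier => v.2 :=
  fun _ _ hp k => hp (k.comp (ContinuousLinearMap.snd ℝ E.carrier F.carrier))

/-- A continuous functional on `E × F` is the sum of its restrictions to the two factors. -/
theorem dSmooth_prod_mk {f : X → E.carrier} {g : X → F.carrier} (hf : DSmooth f)
    (hg : DSmooth g) : DSmooth (Y := (E.prod F).carrier) fun x => (f x, g x) := by
  refine (ConvenientSpace.dSmooth_iff (E := E.prod F) (f := fun x => (f x, g x))).2 fun n p hp l => ?_
  have h1 := hf n p hp (l.comp (ContinuousLinearMap.inl ℝ E.carrier F.carrier))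
  have h2 := hg n p hp (l.comp (ContinuousLinearMap.inr ℝ E.carrier F.carrier))
  convert! h1.add h2 using 1
  funext t
  have h : ((f (p t), g (p t)) : E.carrier × F.carrier) = (f (p t), 0) + (0, g (p t)) := by simp
  exact (congrArg l h).trans (map_add l _ _)

end ConvenientSpace

/-! ### Constructions of manifolds -/

/-- The point `x` has an open neighbourhood diffeomorphic to an open subset of a convenient vector
space. -/
def HasChartAt {X : Type u} [DiffeologicalSpace X] (x : X) : Prop :=
  ∃ (E : ConvenientSpace.{u}) (U : Set X) (V : Set E.carrier) (φ : U ≃ V),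
    x ∈ U ∧ IsOpen[dTopology] U ∧ IsOpen[dTopology] V ∧ DSmooth φ ∧ DSmooth φ.symm

section Manifold

variable {X Y : Type u} [DiffeologicalSpace X] [DiffeologicalSpace Y]

/-- Charts are transported by diffeomorphisms onto open subsets. -/
theorem HasChartAt.of_equiv {W : Set Y} (hW : IsOpen[dTopology] W) (j : X ≃ W) (hj : DSmooth j)
    (hj' : DSmooth j.symm) {x : X} (hx : HasChartAt x) : HasChartAt (j x : Y) := by
  obtain ⟨E, U, V, φ, hxU, hU, hV, hφ, hφ'⟩ := hx
  have hmem : ∀ y : (Subtype.val '' (j.symm ⁻¹' U) : Set Y), ∃ h : y.1 ∈ W, j.symm ⟨y, h⟩ ∈ U := by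
    rintro ⟨_, w, hw, rfl⟩
    exact ⟨w.2, hw⟩
  refine ⟨E, Subtype.val '' (j.symm ⁻¹' U), V,
    { toFun := fun y => φ ⟨j.symm ⟨y, (hmem y).1⟩, (hmem y).2⟩
      invFun := fun v => ⟨j (φ.symm v), j (φ.symm v), by simp, rfl⟩
      left_inv := fun y => by simp
      right_inv := fun v => by simp }, ⟨j x, by simpa using hxU, rfl⟩,
    isOpen_image_val hW (isOpen_preimage hj' hU), hV, ?_, ?_⟩
  · exact hφ.comp' (dSmooth_subtype_mk (hj'.comp' (by fun_prop)) _)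
  · exact dSmooth_subtype_mk (dSmooth_val (hj.comp' (dSmooth_val hφ'))) _

theorem IsSmoothManifold.of_equiv (hX : IsSmoothManifold X) (e : X ≃ Y) (he : DSmooth e)
    (he' : DSmooth e.symm) : IsSmoothManifold Y where
  t2 := t2Space_of_injective he' e.symm.injective hX.t2
  chart y := by
    have h := HasChartAt.of_equiv (W := Set.univ) (@isOpen_univ _ dTopology)
      (e.trans (Equiv.Set.univ Y).symm) (dSmooth_of_val he) (he'.comp' dSmooth_subtype_val)
      (hX.chart (e.symm y))
    rwa [show ((e.trans (Equiv.Set.univ Y).symm (e.symm y) : Set.univ) : Y) = y by simp] at h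

/-- A chart is cut down on both sides: its target becomes the part of `V` that `φ.symm` sends into
`U`, which is open in `V` and hence, by `isOpen_image_val`, in the model space. -/
theorem IsSmoothManifold.of_isOpen (hX : IsSmoothManifold X) {U : Set X}
    (hU : IsOpen[dTopology] U) : IsSmoothManifold U where
  t2 := t2Space_of_injective dSmooth_subtype_val Subtype.val_injective hX.t2
  chart x := by
    obtain ⟨E, U₀, V, φ, hxU, hU₀, hV, hφ, hφ'⟩ := hX.chart x
    have hmem : ∀ v : (Subtype.val '' {v : V | (φ.symm v : X) ∈ U} : Set E.carrier),
        ∃ h : v.1 ∈ V, (φ.symm ⟨v, h⟩ : X) ∈ U := by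
      rintro ⟨_, w, hw, rfl⟩
      exact ⟨w.2, hw⟩
    refine ⟨E, {y : U | y.1 ∈ U₀}, Subtype.val '' {v : V | (φ.symm v : X) ∈ U},
      { toFun := fun y => ⟨φ ⟨y.1, y.2⟩, φ ⟨y.1, y.2⟩, by simp, rfl⟩
        invFun := fun v => ⟨⟨φ.symm ⟨v, (hmem v).1⟩, (hmem v).2⟩, (φ.symm ⟨v, (hmem v).1⟩).2⟩
        left_inv := fun y => by simp
        right_inv := fun v => by simp }, hxU, isOpen_preimage dSmooth_subtype_val hU₀,
      isOpen_image_val hV (isOpen_preimage (dSmooth_val hφ') hU), ?_, ?_⟩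
    · exact dSmooth_subtype_mk (dSmooth_val (hφ.comp' (by fun_prop))) _
    · exact dSmooth_subtype_mk (dSmooth_subtype_mk (dSmooth_val (hφ'.comp' (by fun_prop))) _) _

theorem IsSmoothManifold.prod (hX : IsSmoothManifold X) (hY : IsSmoothManifold Y) :
    IsSmoothManifold (X × Y) where
  t2 := by
    let _ : TopologicalSpace X := dTopology
    let _ : TopologicalSpace Y := dTopology
    let _ : TopologicalSpace (X × Y) := dTopology
    have := hX.t2
    have := hY.t2
    -- No comparison of the D-topology of `X × Y` with the product topology is needed: continuous
    -- projections suffice to separate points.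
    have h1 : Continuous (Prod.fst : X × Y → X) := (dSmooth_fst dSmooth_id').continuous
    have h2 : Continuous (Prod.snd : X × Y → Y) := (dSmooth_snd dSmooth_id').continuous
    refine ⟨fun p q hpq => ?_⟩
    by_cases h : p.1 = q.1
    · exact separated_by_continuous h2 fun h' => hpq (Prod.ext h h')
    · exact separated_by_continuous h1 h
  chart p := by
    obtain ⟨E, U, V, φ, hxU, hU, hV, hφ, hφ'⟩ := hX.chart p.1
    obtain ⟨F, U', V', ψ, hxU', hU', hV', hψ, hψ'⟩ := hY.chart p.2
    refine ⟨E.prod F, {q | q.1 ∈ U ∧ q.2 ∈ U'}, {v | v.1 ∈ V ∧ v.2 ∈ V'},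
      { toFun := fun q => ⟨(φ ⟨q.1.1, q.2.1⟩, ψ ⟨q.1.2, q.2.2⟩), Subtype.coe_prop _,
          Subtype.coe_prop _⟩
        invFun := fun v => ⟨(φ.symm ⟨v.1.1, v.2.1⟩, ψ.symm ⟨v.1.2, v.2.2⟩), Subtype.coe_prop _,
          Subtype.coe_prop _⟩
        left_inv := fun q => by simp
        right_inv := fun v => by simp; rfl }, ⟨hxU, hxU'⟩,
      isOpen_inter (isOpen_preimage (dSmooth_fst dSmooth_id') hU)
        (isOpen_preimage (dSmooth_snd dSmooth_id') hU'),
      isOpen_inter (isOpen_preimage ConvenientSpace.dSmooth_prod_fst hV)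
        (isOpen_preimage ConvenientSpace.dSmooth_prod_snd hV'), ?_, ?_⟩
    · refine dSmooth_of_val ?_
      exact ConvenientSpace.dSmooth_prod_mk
        (dSmooth_val (hφ.comp' (dSmooth_subtype_mk (dSmooth_fst dSmooth_subtype_val) _)))
        (dSmooth_val (hψ.comp' (dSmooth_subtype_mk (dSmooth_snd dSmooth_subtype_val) _)))
    · refine dSmooth_subtype_mk (dSmooth_prodMk (dSmooth_val (hφ'.comp' ?_))
        (dSmooth_val (hψ'.comp' ?_))) _
      · exact dSmooth_subtype_mk (ConvenientSpace.dSmooth_prod_fst.comp' dSmooth_subtype_val) _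
      · exact dSmooth_subtype_mk (ConvenientSpace.dSmooth_prod_snd.comp' dSmooth_subtype_val) _

theorem IsSmoothManifold.of_unique [Unique X] : IsSmoothManifold X where
  t2 := @T2Space.mk X dTopology fun x y h => (h (Subsingleton.elim x y)).elim
  chart _ := ⟨ConvenientSpace.zero, Set.univ, Set.univ,
    { toFun := fun _ => ⟨PUnit.unit, trivial⟩
      invFun := fun _ => ⟨default, trivial⟩
      left_inv := fun _ => Subsingleton.elim _ _
      right_inv := fun _ => rfl }, trivial, @isOpen_univ _ dTopology,
    @isOpen_univ _ dTopology, dSmooth_const, dSmooth_const⟩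

theorem IsSmoothManifold.finPow (hX : IsSmoothManifold X) (n : ℕ) :
    IsSmoothManifold (Fin n → X) := by
  induction n with
  | zero => exact .of_unique
  | succ n ih =>
    refine (hX.prod ih).of_equiv (Fin.consEquiv fun _ => X) (dSmooth_pi fun i => ?_) ?_
    · refine Fin.cases ?_ (fun i => ?_) i
      · exact dSmooth_fst dSmooth_id'
      · exact dSmooth_apply (dSmooth_snd dSmooth_id') i
    · exact dSmooth_prodMk (dSmooth_apply dSmooth_id' _)
        (dSmooth_pi fun i => dSmooth_apply dSmooth_id' _)

end Manifold

/-! ### Principal bundles and their fibre powers -/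

section FibrePower

variable {X M : Type u} [DiffeologicalSpace X] {π : X → M} {Z : Type*} [DiffeologicalSpace Z]

theorem dSmooth_fibrePower_apply {p : ℕ} (k : Fin (p + 1)) :
    DSmooth fun x : FibrePower π p => x.1 k :=
  fun _ _ h => h k

theorem dSmooth_fibrePower_of_apply {p : ℕ} {f : Z → FibrePower π p}
    (h : ∀ k, DSmooth fun z => (f z).1 k) : DSmooth f :=
  fun n q hq k => h k n q hq

theorem dSmooth_cech_map [DiffeologicalSpace M] {m n : ℕ} (θ : Fin (m + 1) →o Fin (n + 1)) :
    DSmooth ((cech π).map θ) :=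
  dSmooth_fibrePower_of_apply fun k => dSmooth_fibrePower_apply (θ k)

variable (π) in
/-- The first fibre power is the space itself. -/
def fibrePowerZeroEquiv : FibrePower π 0 ≃ X where
  toFun x := x.1 0
  invFun x := ⟨fun _ => x, fun _ _ => rfl⟩
  left_inv x := Subtype.ext (funext fun i => congrArg x.1 (Fin.fin_one_eq_zero i).symm)
  right_inv _ := rfl

/-- `IsLocallySplit` records manifolds only for the base and the fibre powers; the total space is
the fibre power of index `0`. -/
theorem IsLocallySplit.manifold_total [DiffeologicalSpace M] (h : IsLocallySplit π) :
    IsSmoothManifold X :=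
  (h.manifold_fibrePower 0).of_equiv (fibrePowerZeroEquiv π) (dSmooth_fibrePower_apply 0)
    (dSmooth_fibrePower_of_apply fun _ => dSmooth_id')

end FibrePower

/-! ### Smooth products in a Lie group -/

section Group

variable {G Z : Type u} [Group G] [DiffeologicalSpace G] [DiffeologicalSpace Z]

theorem IsLieGroup.dSmooth_mul (hG : IsLieGroup G) {f g : Z → G} (hf : DSmooth f)
    (hg : DSmooth g) : DSmooth fun z => f z * g z :=
  hG.smooth_mul.comp' (dSmooth_prodMk hf hg)

theorem IsLieGroup.dSmooth_partialProd (hG : IsLieGroup G) {n : ℕ} (k : Fin (n + 1)) :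
    DSmooth fun g : Fin n → G => Fin.partialProd g k := by
  induction k using Fin.induction with
  | zero => simpa only [Fin.partialProd_zero] using dSmooth_const
  | succ k ih =>
    simp only [Fin.partialProd_succ]
    exact hG.dSmooth_mul ih (dSmooth_apply dSmooth_id' k)

end Group

/-! ### Division and fibre powers of a principal bundle -/

namespace IsPrincipalBundle

variable {G P M : Type u} [Group G] [DiffeologicalSpace G] [DiffeologicalSpace P]
  [DiffeologicalSpace M] {π : P → M} {ρ : P → G → P}

theorem dSmooth_act (h : IsPrincipalBundle π ρ) {Z : Type*} [DiffeologicalSpace Z] {f : Z → P}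
    {g : Z → G} (hf : DSmooth f) (hg : DSmooth g) : DSmooth fun z => ρ (f z) (g z) :=
  h.smooth_act.comp' (dSmooth_prodMk hf hg)

/-- The division map `P^{[2]} → G` is smooth. -/
theorem dSmooth_div (h : IsPrincipalBundle π ρ) (hG : IsLieGroup G) :
    DSmooth fun x : {x : P × P // π x.1 = π x.2} => h.div x.2 := by
  refine dSmooth_of_local fun x => ?_
  obtain ⟨U, φ, hxU, hU, hφ, hφ', hπ, hact⟩ := h.localTriv (π x.1.1)
  refine ⟨{x | π x.1.1 ∈ U}, hxU,
    isOpen_preimage (h.smooth_proj.comp' (dSmooth_fst dSmooth_subtype_val)) hU, ?_⟩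
  -- In a trivialisation the two points are `φ (t, g)` and `φ (t, k)` over the same `t`, so their
  -- quotient is `g⁻¹ * k`, visibly smooth.
  have key : ∀ y : {x : {x : P × P // π x.1 = π x.2} | π x.1.1 ∈ U}, h.div y.1.2 =
      (φ.symm ⟨y.1.1.1, y.2⟩).2⁻¹ *
        (φ.symm ⟨y.1.1.2, show π y.1.1.2 ∈ U from y.1.2 ▸ y.2⟩).2 := by
    rintro ⟨⟨⟨p, q⟩, hpq⟩, hp⟩
    have hq : π q ∈ U := (show π p = π q from hpq) ▸ hp
    refine (h.div_unique hpq ?_).symm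
    obtain ⟨⟨t, g⟩, htg⟩ := φ.surjective ⟨p, hp⟩
    obtain ⟨⟨s, k⟩, hsk⟩ := φ.surjective ⟨q, hq⟩
    have hp' : (φ (t, g) : P) = p := congrArg Subtype.val htg
    have hq' : (φ (s, k) : P) = q := congrArg Subtype.val hsk
    have hts : t = s := Subtype.ext (by
      rw [← hπ t g, ← hπ s k, hp', hq']; exact hpq)
    subst hts
    show ρ p ((φ.symm ⟨p, hp⟩).2⁻¹ * (φ.symm ⟨q, hq⟩).2) = q
    rw [← htg, ← hsk, φ.symm_apply_apply, φ.symm_apply_apply, ← hp', ← hact, ← hq']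
    simp
  simp only [key]
  refine hG.dSmooth_mul (hG.smooth_inv.comp' (dSmooth_snd (hφ'.comp' (dSmooth_of_val ?_))))
    (dSmooth_snd (hφ'.comp' (dSmooth_of_val ?_)))
  · exact dSmooth_fst (dSmooth_val dSmooth_subtype_val)
  · exact dSmooth_snd (dSmooth_val dSmooth_subtype_val)

theorem dSmooth_tauFun (h : IsPrincipalBundle π ρ) (hG : IsLieGroup G) (n : ℕ) :
    DSmooth (tauFun h n) := by
  refine dSmooth_pi fun i => ?_
  exact (h.dSmooth_div hG).comp' (f := fun x : FibrePower π n =>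
      (⟨(x.1 i.castSucc, x.1 i.succ), x.2 _ _⟩ : {x : P × P // π x.1 = π x.2}))
    (dSmooth_subtype_mk (dSmooth_prodMk (dSmooth_fibrePower_apply _)
      (dSmooth_fibrePower_apply _)) _)

/-- The total space of a principal bundle over a manifold is a manifold. -/
theorem manifold_total (h : IsPrincipalBundle π ρ) (hG : IsSmoothManifold G)
    (hM : IsSmoothManifold M) : IsSmoothManifold P where
  t2 := by
    let _ : TopologicalSpace P := dTopology
    refine ⟨fun p q hpq => ?_⟩
    -- Points of one fibre lie in a common trivialised open set `π ⁻¹' U`, diffeomorphic to the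
    -- Hausdorff space `U × G`, and open subsets of it are open in `P`. Points of different fibres
    -- are separated by pulling back from `M`.
    by_cases hπpq : π p = π q
    · obtain ⟨U, φ, hpU, hU, -, hφ', -, -⟩ := h.localTriv (π p)
      have hqU : π q ∈ U := hπpq ▸ hpU
      have hW : IsOpen[dTopology] (π ⁻¹' U) := isOpen_preimage h.smooth_proj hU
      let _ : TopologicalSpace (π ⁻¹' U : Set P) := dTopology
      have ht2 : T2Space (π ⁻¹' U : Set P) :=
        t2Space_of_injective hφ' φ.symm.injective ((hM.of_isOpen hU).prod hG).t2
      obtain ⟨A, B, hA, hB, hpA, hqB, hAB⟩ := ht2.t2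
        (show (⟨p, hpU⟩ : (π ⁻¹' U : Set P)) ≠ ⟨q, hqU⟩ from
          fun h => hpq (congrArg Subtype.val h))
      exact ⟨_, _, isOpen_image_val hW hA, isOpen_image_val hW hB, ⟨_, hpA, rfl⟩,
        ⟨_, hqB, rfl⟩, (Set.disjoint_image_iff Subtype.val_injective).2 hAB⟩
    · let _ : TopologicalSpace M := dTopology
      have := hM.t2
      exact separated_by_continuous h.smooth_proj.continuous hπpq
  chart p := by
    obtain ⟨U, φ, hpU, hU, hφ, hφ', -, -⟩ := h.localTriv (π p)
    have h := HasChartAt.of_equiv (isOpen_preimage h.smooth_proj hU) φ hφ hφ'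
      (((hM.of_isOpen hU).prod hG).chart (φ.symm ⟨p, hpU⟩))
    rwa [φ.apply_symm_apply] at h

/-- The trivialisation `P × G^n ≃ P^{[n+1]}` of the fibre powers of a principal bundle. -/
noncomputable def fibrePowerEquiv (h : IsPrincipalBundle π ρ) (n : ℕ) :
    P × (Fin n → G) ≃ FibrePower π n where
  toFun x := ⟨fun k => ρ x.1 (Fin.partialProd x.2 k), fun i j => by
    rw [h.proj_act, h.proj_act]⟩
  invFun x := (x.1 0, tauFun h n x)
  left_inv x := by
    refine Prod.ext ?_ (funext fun i => Eq.symm ?_)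
    · simp [h.act_one]
    -- Consecutive partial products differ by the factor `x.2 i` on the right, which is thus the
    -- quotient of consecutive points.
    · refine h.div_unique (p := ρ x.1 (Fin.partialProd x.2 i.castSucc))
        (q := ρ x.1 (Fin.partialProd x.2 i.succ))
        ((h.proj_act _ _).trans (h.proj_act _ _).symm) ?_
      rw [← h.act_mul, ← Fin.partialProd_succ]
  right_inv x := Subtype.ext (funext fun k => act_partialProd_tauFun h x k)

theorem dSmooth_fibrePowerEquiv (h : IsPrincipalBundle π ρ) (hG : IsLieGroup G) (n : ℕ) :
    DSmooth (h.fibrePowerEquiv n) :=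
  dSmooth_fibrePower_of_apply fun k => h.dSmooth_act (dSmooth_fst dSmooth_id')
    ((hG.dSmooth_partialProd k).comp' (dSmooth_snd dSmooth_id'))

theorem dSmooth_fibrePowerEquiv_symm (h : IsPrincipalBundle π ρ) (hG : IsLieGroup G) (n : ℕ) :
    DSmooth (h.fibrePowerEquiv n).symm :=
  dSmooth_prodMk (dSmooth_fibrePower_apply 0) (h.dSmooth_tauFun hG n)

/-- In these coordinates `τ` is a projection with fibre `P`; this is what turns pullbacks along `τ`
into products. -/
theorem tauFun_fibrePowerEquiv (h : IsPrincipalBundle π ρ) (n : ℕ) (x : P × (Fin n → G)) :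
    tauFun h n (h.fibrePowerEquiv n x) = x.2 :=
  congrArg Prod.snd ((h.fibrePowerEquiv n).symm_apply_apply x)

theorem manifold_fibrePower (h : IsPrincipalBundle π ρ) (hG : IsLieGroup G)
    (hM : IsSmoothManifold M) (n : ℕ) : IsSmoothManifold (FibrePower π n) :=
  ((h.manifold_total hG.manifold hM).prod (hG.manifold.finPow n)).of_equiv (h.fibrePowerEquiv n)
    (h.dSmooth_fibrePowerEquiv hG n) (h.dSmooth_fibrePowerEquiv_symm hG n)

theorem isLocallySplit (h : IsPrincipalBundle π ρ) (hG : IsLieGroup G)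
    (hM : IsSmoothManifold M) : IsLocallySplit π where
  smooth := h.smooth_proj
  surjective := h.surjective
  localSection b := by
    obtain ⟨U, φ, hbU, hU, hφ, -, hπ, -⟩ := h.localTriv b
    exact ⟨U, fun t => φ (t, 1), hbU, hU,
      dSmooth_val (hφ.comp' (dSmooth_prodMk dSmooth_id' dSmooth_const)), fun t => hπ t 1⟩
  manifold_base := hM
  manifold_fibrePower := h.manifold_fibrePower hG hM

end IsPrincipalBundle

/-! ### Pullback along a trivial projection -/

/-- `f : N' → N` is a trivial smooth projection with fibre `F`, with trivialisation `e`. -/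
structure IsTrivialProjection {F N N' : Type*} [DiffeologicalSpace F] [DiffeologicalSpace N]
    [DiffeologicalSpace N'] (f : N' → N) (e : F × N ≃ N') : Prop where
  smooth : DSmooth e
  smooth_symm : DSmooth e.symm
  map_eq : ∀ x, f (e x) = x.2

namespace IsTrivialProjection

variable {F N N' Z : Type u} [DiffeologicalSpace F] [DiffeologicalSpace N]
  [DiffeologicalSpace N'] [DiffeologicalSpace Z] {f : N' → N} {e : F × N ≃ N'}

theorem eq_symm_snd (h : IsTrivialProjection f e) (x : N') : f x = (e.symm x).2 := by
  rw [← h.map_eq, e.apply_symm_apply]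

/-- The pullback of `r : Z → N` along a trivial projection with fibre `F` is a manifold if `F` and
`Z` are. -/
theorem manifold_pullback (h : IsTrivialProjection f e) (hF : IsSmoothManifold F)
    (hZ : IsSmoothManifold Z) {r : Z → N} (hr : DSmooth r) :
    IsSmoothManifold {p : N' × Z // r p.2 = f p.1} := by
  -- The `N`-coordinate of a point of `N' ≅ F × N` is forced to be `r z`, leaving `F × Z`.
  refine (hF.prod hZ).of_equiv
    { toFun := fun x => ⟨(e (x.1, r x.2), x.2), by rw [h.map_eq]⟩
      invFun := fun p => ((e.symm p.1.1).1, p.1.2)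
      left_inv := fun x => by simp
      right_inv := fun p => Subtype.ext (Prod.ext ?_ rfl) } ?_ ?_
  · simp only [p.2, h.eq_symm_snd]
    exact e.apply_symm_apply _
  · exact dSmooth_of_val (dSmooth_prodMk (h.smooth.comp' (dSmooth_prodMk (dSmooth_fst dSmooth_id')
      (hr.comp' (dSmooth_snd dSmooth_id')))) (dSmooth_snd dSmooth_id'))
  · exact dSmooth_prodMk (dSmooth_fst (h.smooth_symm.comp' (dSmooth_fst dSmooth_subtype_val)))
      (dSmooth_snd dSmooth_subtype_val)

/-- The pullback of a locally split map of manifolds along a trivial projection is locally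
split. -/
theorem isLocallySplit_pullback (h : IsTrivialProjection f e) (hf : DSmooth f)
    (hF : IsSmoothManifold F) (hN' : IsSmoothManifold N') {r : Z → N} (hr : IsLocallySplit r) :
    IsLocallySplit fun p : {p : N' × Z // r p.2 = f p.1} => p.1.1 where
  smooth := dSmooth_fst dSmooth_subtype_val
  surjective x := by
    obtain ⟨z, hz⟩ := hr.surjective (f x)
    exact ⟨⟨(x, z), hz⟩, rfl⟩
  localSection x := by
    obtain ⟨U, s, hxU, hU, hs, hsr⟩ := hr.localSection (f x)
    refine ⟨f ⁻¹' U, fun t => ⟨(t, s ⟨f t, t.2⟩), hsr _⟩, hxU, isOpen_preimage hf hU, ?_,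
      fun t => rfl⟩
    exact dSmooth_of_val (dSmooth_prodMk dSmooth_subtype_val
      (hs.comp' (dSmooth_of_val (hf.comp' dSmooth_subtype_val))))
  manifold_base := hN'
  manifold_fibrePower p := by
    -- All entries of a point of a fibre power of the pullback share their `N'`-coordinate, so this
    -- fibre power is the pullback of the fibre power of `r`, to which the previous result applies.
    have hm := h.manifold_pullback hF (hr.manifold_fibrePower p)
      (r := fun z => r (z.1 0)) (hr.smooth.comp' (dSmooth_fibrePower_apply 0))
    refine hm.of_equiv
      { toFun := fun x => ⟨fun k => ⟨(x.1.1, x.1.2.1 k), (x.1.2.2 k 0).trans x.2⟩,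
          fun _ _ => rfl⟩
        invFun := fun y => ⟨((y.1 0).1.1, ⟨fun k => (y.1 k).1.2, fun i j =>
          (y.1 i).2.trans ((congrArg f (y.2 i j)).trans (y.1 j).2.symm)⟩), (y.1 0).2⟩
        left_inv := fun _ => rfl
        right_inv := fun y => Subtype.ext (funext fun k => Subtype.ext
          (Prod.ext (y.2 0 k) rfl)) } ?_ ?_
    · exact dSmooth_fibrePower_of_apply fun k => dSmooth_of_val (dSmooth_prodMk
        (dSmooth_fst dSmooth_subtype_val)
        ((dSmooth_fibrePower_apply k).comp' (dSmooth_snd dSmooth_subtype_val)))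
    · exact dSmooth_of_val (dSmooth_prodMk
        (dSmooth_fst (dSmooth_val (dSmooth_fibrePower_apply 0)))
        (dSmooth_fibrePower_of_apply fun k =>
          dSmooth_snd (dSmooth_val (dSmooth_fibrePower_apply k))))

end IsTrivialProjection

/-! ### Pullbacks of bundle gerbes -/

/-- The pullback of a principal bundle along a smooth map is a principal bundle. -/
theorem IsPrincipalBundle.pullback {G P B P' B' : Type*} [Group G] [DiffeologicalSpace G]
    [DiffeologicalSpace P] [DiffeologicalSpace B] [DiffeologicalSpace P'] [DiffeologicalSpace B']
    {π : P → B} {ρ : P → G → P} {π' : P' → B'} {ρ' : P' → G → P'} (h : IsPrincipalBundle π ρ)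
    {g : B' → B} (hg : DSmooth g) (c : {x : B' × P // π x.2 = g x.1} ≃ P') (hc : DSmooth c)
    (hc' : DSmooth c.symm) (hπ : ∀ x, π' (c x) = x.1.1)
    (hρ : ∀ x z, ρ' (c x) z = c ⟨(x.1.1, ρ x.1.2 z), (h.proj_act _ _).trans x.2⟩) :
    IsPrincipalBundle π' ρ' := by
  -- The given bundle is only diffeomorphic, through `c`, to the literal fibre product; its
  -- projection and action are first rewritten in terms of `c`.
  have hπ' : ∀ p, π' p = (c.symm p).1.1 := fun p => by rw [← hπ, c.apply_symm_apply]
  have hρ' : ∀ p z, ρ' p z = c ⟨((c.symm p).1.1, ρ (c.symm p).1.2 z),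
      (h.proj_act _ _).trans (c.symm p).2⟩ := fun p z => by rw [← hρ, c.apply_symm_apply]
  have smooth_proj : DSmooth π' := by
    rw [show π' = _ from funext hπ']
    exact dSmooth_fst (dSmooth_val hc')
  refine ⟨smooth_proj, ?_, fun p => ?_, fun p z w => ?_, fun p z => ?_, fun b => ?_⟩
  · simp only [hρ']
    have h1 : DSmooth fun q : P' × G => (c.symm q.1).1 :=
      dSmooth_val (hc'.comp' (dSmooth_fst dSmooth_id'))
    exact hc.comp' (dSmooth_of_val (dSmooth_prodMk (dSmooth_fst h1)
      (h.smooth_act.comp' (dSmooth_prodMk (dSmooth_snd h1) (dSmooth_snd dSmooth_id')))))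
  · simp only [hρ', h.act_one, Prod.mk.eta, Subtype.coe_eta, c.apply_symm_apply]
  · simp only [hρ', h.act_mul, c.symm_apply_apply]
  · rw [hρ', hπ, hπ']
  · obtain ⟨U, φ, hbU, hU, hφ, hφ', hφπ, hφρ⟩ := h.localTriv (g b)
    have hmem : ∀ p : (π' ⁻¹' (g ⁻¹' U) : Set P'), (c.symm p).1.2 ∈ π ⁻¹' U := fun p => by
      show π _ ∈ U
      rw [(c.symm p).2, ← hπ']
      exact p.2
    refine ⟨g ⁻¹' U,
      { toFun := fun x => ⟨c ⟨(x.1.1, φ (⟨g x.1, x.1.2⟩, x.2)), hφπ _ _⟩, by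
          show g (π' _) ∈ U
          rw [hπ]
          exact x.1.2⟩
        invFun := fun p => (⟨π' p, p.2⟩, (φ.symm ⟨(c.symm p).1.2, hmem p⟩).2)
        left_inv := fun x => by simp [hπ]
        right_inv := fun p => Subtype.ext (c.symm.injective (Subtype.ext (Prod.ext ?_ ?_))) },
      hbU, isOpen_preimage hg hU, ?_, ?_, fun t z => hπ _, fun t z w => ?_⟩
    · simp [hπ']
    · simp only [Equiv.symm_apply_apply]
      -- The base coordinate `t` is no free datum: the fibre product condition makes it `g (π' p)`.
      obtain ⟨⟨t, z⟩, htz⟩ := φ.surjective ⟨(c.symm p).1.2, hmem p⟩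
      have ht : (⟨g (π' p), p.2⟩ : U) = t := Subtype.ext (by
        rw [← hφπ t z, htz]
        exact (congrArg g (hπ' p)).trans (c.symm p).2.symm)
      rw [← htz, φ.symm_apply_apply, ht, htz]
    · exact dSmooth_of_val (hc.comp' (dSmooth_of_val (dSmooth_prodMk
        (dSmooth_val (dSmooth_fst dSmooth_id')) (dSmooth_val (hφ.comp' (dSmooth_prodMk
          (dSmooth_of_val (hg.comp' (dSmooth_val (dSmooth_fst dSmooth_id'))))
          (dSmooth_snd dSmooth_id')))))))
    · exact dSmooth_prodMk (dSmooth_of_val (smooth_proj.comp' dSmooth_subtype_val))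
        (dSmooth_snd (hφ'.comp' (dSmooth_of_val
          (dSmooth_snd (dSmooth_val (hc'.comp' dSmooth_subtype_val))))))
    · simp only [Equiv.coe_fn_mk, hρ, hφρ]

namespace BundleGerbeData

variable {N N' : Type u} {D : BundleGerbeData N}

/-- Allows comparing products factor by factor without transporting the proofs of composability. -/
theorem mul_congr {w w' : {w : D.Q × D.Q // D.src w.1 = D.tgt w.2}} (h : w.1 = w'.1) :
    D.mul w = D.mul w' :=
  congrArg D.mul (Subtype.ext h)

variable [DiffeologicalSpace N'] {f : N' → N}

/-- An element of `Q` composable with `e.1.2` lies over `f e.1.1`, hence lifts to the pullback over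
the base point `e.1.1`, where `e` acts as an identity. -/
theorem IsIdentity.of_pullback {e : (D.pullback f).Q} {y : (D.pullback f).Y}
    (he : (D.pullback f).IsIdentity e y) : D.IsIdentity e.1.2 y.1.2 where
  src_eq := congrArg (fun y => y.1.2) he.src_eq
  tgt_eq := congrArg (fun y => y.1.2) he.tgt_eq
  mul_right u hu := congrArg (fun q => q.1.2) (he.mul_right
    ⟨(e.1.1, u), by rw [hu, D.proj_tgt]; exact e.2⟩ (Subtype.ext (Prod.ext rfl hu)))
  mul_left u hu := congrArg (fun q => q.1.2) (he.mul_left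
    ⟨(e.1.1, u), by rw [← D.proj_tgt, ← hu]; exact e.2⟩ (Subtype.ext (Prod.ext rfl hu)))

variable [DiffeologicalSpace N]

theorem IsBundleGerbe.dSmooth_src (hD : D.IsBundleGerbe) : DSmooth D.src :=
  dSmooth_fst (dSmooth_val hD.principal.smooth_proj)

theorem IsBundleGerbe.dSmooth_tgt (hD : D.IsBundleGerbe) : DSmooth D.tgt :=
  dSmooth_snd (dSmooth_val hD.principal.smooth_proj)

/-- The map `(f⁻¹Y)^{[2]} → Y^{[2]}`. -/
def pullbackYSq (y : (D.pullback f).YSq) : D.YSq :=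
  ⟨(y.1.1.1.2, y.1.2.1.2), y.1.2.2.trans ((congrArg f y.2).trans y.1.1.2.symm)⟩

/-- `f⁻¹Q` is the pullback of `Q` along `(f⁻¹Y)^{[2]} → Y^{[2]}`. -/
def pullbackQEquiv : {x : (D.pullback f).YSq × D.Q // D.toYSq x.2 = pullbackYSq x.1} ≃
    (D.pullback f).Q where
  toFun x := ⟨(x.1.1.1.1.1.1, x.1.2), by
    have h : D.src x.1.2 = x.1.1.1.1.1.2 := congrArg (fun y => y.1.1) x.2
    rw [h]
    exact x.1.1.1.1.2⟩
  invFun q := ⟨((D.pullback f).toYSq q, q.1.2), rfl⟩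
  left_inv x := by
    have h1 : D.src x.1.2 = x.1.1.1.1.1.2 := congrArg (fun y => y.1.1) x.2
    have h2 : D.tgt x.1.2 = x.1.1.1.2.1.2 := congrArg (fun y => y.1.2) x.2
    exact Subtype.ext (Prod.ext (Subtype.ext (Prod.ext (Subtype.ext (Prod.ext rfl h1))
      (Subtype.ext (Prod.ext x.1.1.2.symm h2)))) rfl)
  right_inv _ := rfl

theorem IsBundleGerbe.dSmooth_pullback_toYSq (hD : D.IsBundleGerbe) :
    DSmooth (D.pullback f).toYSq :=
  dSmooth_of_val (dSmooth_prodMk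
    (dSmooth_of_val (dSmooth_prodMk (dSmooth_fst dSmooth_subtype_val)
      (hD.dSmooth_src.comp' (dSmooth_snd dSmooth_subtype_val))))
    (dSmooth_of_val (dSmooth_prodMk (dSmooth_fst dSmooth_subtype_val)
      (hD.dSmooth_tgt.comp' (dSmooth_snd dSmooth_subtype_val)))))

theorem IsBundleGerbe.principal_pullback (hD : D.IsBundleGerbe) :
    IsPrincipalBundle (D.pullback f).toYSq (D.pullback f).act := by
  refine hD.principal.pullback (g := pullbackYSq) ?_ pullbackQEquiv ?_ ?_ (fun x => ?_)
    (fun x z => rfl)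
  · exact dSmooth_of_val (dSmooth_prodMk
      (dSmooth_snd (dSmooth_val (dSmooth_fst dSmooth_subtype_val)))
      (dSmooth_snd (dSmooth_val (dSmooth_snd dSmooth_subtype_val))))
  · have h : DSmooth fun x : {x : (D.pullback f).YSq × D.Q // D.toYSq x.2 = pullbackYSq x.1} =>
        x.1.1.1.1 := dSmooth_fst (dSmooth_val (dSmooth_fst dSmooth_subtype_val))
    exact dSmooth_of_val (dSmooth_prodMk (dSmooth_fst (dSmooth_val h))
      (dSmooth_snd dSmooth_subtype_val))
  · exact dSmooth_of_val (dSmooth_prodMk hD.dSmooth_pullback_toYSq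
      (dSmooth_snd dSmooth_subtype_val))
  · exact congrArg (fun x => x.1.1) (pullbackQEquiv.symm_apply_apply x)

/-- The pullback of a bundle gerbe is a bundle gerbe as soon as it consists of manifolds. -/
theorem IsBundleGerbe.pullback (hD : D.IsBundleGerbe)
    (hY : IsLocallySplit (D.pullback f).proj) (hQ : IsSmoothManifold (D.pullback f).Q) :
    (D.pullback f).IsBundleGerbe where
  locallySplit := hY
  manifold := hQ
  principal := hD.principal_pullback
  smooth_mul := dSmooth_of_val (dSmooth_prodMk
    (dSmooth_fst (dSmooth_val (dSmooth_snd dSmooth_subtype_val)))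
    (hD.smooth_mul.comp' (dSmooth_of_val (dSmooth_prodMk
      (dSmooth_snd (dSmooth_val (dSmooth_fst dSmooth_subtype_val)))
      (dSmooth_snd (dSmooth_val (dSmooth_snd dSmooth_subtype_val)))))))
  mul_act u v h z w := Subtype.ext (Prod.ext rfl
    (hD.mul_act u.1.2 v.1.2 (congrArg (fun y => y.1.2) h) z w))
  mul_assoc u v w h h' := Subtype.ext (Prod.ext rfl
    (hD.mul_assoc u.1.2 v.1.2 w.1.2 (congrArg (fun y => y.1.2) h)
      (congrArg (fun y => y.1.2) h')))

end BundleGerbeData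

/-! ### Pullbacks of simplicial bundle gerbes -/

namespace MultiplicativeData

variable {X X' : SimplicialSpace.{u}} {D : MultiplicativeData X} {f : SimplicialMap X' X}

theorem mhat_congr {q q' : D.Q2} (h : q.1 = q'.1) : D.mhat q = D.mhat q' :=
  congrArg D.mhat (Subtype.ext h)

/-- The map `f⁻¹Q ∘ f⁻¹Q → Q ∘ Q`. -/
def pullbackQ2 (q : (D.pullback f).Q2) : D.Q2 :=
  ⟨(f.app 2 q.1.1, q.1.2.1.1.2, q.1.2.2.1.2),
    q.1.2.1.2.trans ((congrArg (f.app 1) q.2.1).trans (f.app_d 0 q.1.1)),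
    q.1.2.2.2.trans ((congrArg (f.app 1) q.2.2).trans (f.app_d 2 q.1.1))⟩

/-- The pullback of a bundle gerbe morphism is a bundle gerbe morphism. -/
theorem IsMorphism.pullback (hD : D.IsMorphism) (hf : f.IsSmooth)
    (hX' : X'.IsSimplicialManifold) : (D.pullback f).IsMorphism where
  smooth_m := dSmooth_of_val (dSmooth_prodMk
    ((hX'.smooth _).comp' (dSmooth_fst dSmooth_subtype_val))
    (hD.smooth_m.comp' (dSmooth_of_val (dSmooth_prodMk
      ((hf 2).comp' (dSmooth_fst dSmooth_subtype_val)) (dSmooth_prodMk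
        (dSmooth_snd (dSmooth_val (dSmooth_fst (dSmooth_snd dSmooth_subtype_val))))
        (dSmooth_snd (dSmooth_val (dSmooth_snd (dSmooth_snd dSmooth_subtype_val)))))))))
  smooth_mhat := dSmooth_of_val (dSmooth_prodMk
    ((hX'.smooth _).comp' (dSmooth_fst dSmooth_subtype_val))
    (hD.smooth_mhat.comp' (dSmooth_of_val (dSmooth_prodMk
      ((hf 2).comp' (dSmooth_fst dSmooth_subtype_val)) (dSmooth_prodMk
        (dSmooth_snd (dSmooth_val (dSmooth_fst (dSmooth_snd dSmooth_subtype_val))))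
        (dSmooth_snd (dSmooth_val (dSmooth_snd (dSmooth_snd dSmooth_subtype_val)))))))))
  mhat_act q q' z w h := by
    obtain ⟨q', hq'⟩ := q'
    subst h
    exact Subtype.ext (Prod.ext rfl (hD.mhat_act _ _ z w rfl))
  mhat_mul q q' h h₁ h₂ q'' h'' := by
    obtain ⟨q'', hq''⟩ := q''
    subst h''
    -- The pulled-back product takes its base point from the right factor, here `q'`, while the
    -- other side carries that of `q`.
    have hx : q.1.1 = q'.1.1 := congrArg (fun y => y.1.1) h
    have h₁' := congrArg (fun y => y.1.2) h₁
    have h₂' := congrArg (fun y => y.1.2) h₂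
    refine Subtype.ext (Prod.ext (congrArg (X'.d 1) hx) (hD.mhat_mul (pullbackQ2 q)
      (pullbackQ2 q') (Subtype.ext
        (Prod.ext (congrArg (f.app 2) hx) (Prod.ext h₁' h₂'))) h₁' h₂' _ rfl))

/-- The map `f⁻¹Q ∘ f⁻¹Q ∘ f⁻¹Q → Q ∘ Q ∘ Q`. -/
def pullbackQ3 (q : (D.pullback f).Q3) : D.Q3 :=
  ⟨(f.app 3 q.1.1, q.1.2.1.1.2, q.1.2.2.1.1.2, q.1.2.2.2.1.2),
    (D.pullbackY3 f ((D.pullback f).src3 q)).2⟩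

/-- The components in `Q` agree on the nose; only the base points of the outer and the inner `m̂`
have to be moved through `f`, by naturality for `d₂` and `d₀`. -/
theorem mhat1_pullback (q : (D.pullback f).Q3) :
    ((D.pullback f).mhat1 q).1.2 = D.mhat1 (pullbackQ3 q) :=
  mhat_congr (Prod.ext (f.app_d 2 q.1.1) (Prod.ext (mhat_congr (Prod.ext (f.app_d 0 q.1.1) rfl))
    rfl))

theorem mhat2_pullback (q : (D.pullback f).Q3) :
    ((D.pullback f).mhat2 q).1.2 = D.mhat2 (pullbackQ3 q) :=
  mhat_congr (Prod.ext (f.app_d 1 q.1.1) (Prod.ext rfl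
    (mhat_congr (Prod.ext (f.app_d 3 q.1.1) rfl))))

end MultiplicativeData

namespace SimplicialBundleGerbeData

variable {X X' : SimplicialSpace.{u}} {D : SimplicialBundleGerbeData X} {f : SimplicialMap X' X}

/-- The pullback of a transformation is a transformation. -/
theorem IsTransformation.pullback (hD : D.IsTransformation) (hf : f.IsSmooth)
    (hX' : X'.IsSimplicialManifold) : (D.pullback f).IsTransformation where
  smooth_a := dSmooth_of_val (dSmooth_prodMk
    ((hX'.smooth _).comp' ((hX'.smooth _).comp' (dSmooth_fst dSmooth_subtype_val)))
    (hD.smooth_a.comp' (dSmooth_of_val (dSmooth_prodMk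
      ((hf 3).comp' (dSmooth_fst dSmooth_subtype_val)) (dSmooth_prodMk
        (dSmooth_snd (dSmooth_val (dSmooth_fst (dSmooth_snd dSmooth_subtype_val)))) (dSmooth_prodMk
        (dSmooth_snd (dSmooth_val
          (dSmooth_fst (dSmooth_snd (dSmooth_snd dSmooth_subtype_val)))))
        (dSmooth_snd (dSmooth_val
          (dSmooth_snd (dSmooth_snd (dSmooth_snd dSmooth_subtype_val)))))))))))
  compatible q := by
    -- The right factors `m̂₁(u)` and `â(y)` both have base point `d₁ d₂ x`.
    refine Subtype.ext (Prod.ext rfl ?_)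
    refine (BundleGerbeData.mul_congr ?_).trans
      ((hD.compatible (MultiplicativeData.pullbackQ3 q)).trans (BundleGerbeData.mul_congr ?_))
    · exact Prod.ext rfl (MultiplicativeData.mhat1_pullback q)
    · exact Prod.ext (MultiplicativeData.mhat2_pullback q).symm rfl

/-- The map `f⁻¹Y ∘ f⁻¹Y ∘ f⁻¹Y ∘ f⁻¹Y → Y ∘ Y ∘ Y ∘ Y`. -/
def pullbackY4 (p : (D.pullback f).Y4) : D.Y4 :=
  ⟨(f.app 4 p.1.1, p.1.2.1.1.2, p.1.2.2.1.1.2, p.1.2.2.2.1.1.2, p.1.2.2.2.2.1.2),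
    p.1.2.1.2.trans ((congrArg (f.app 1) p.2.1).trans (by simp only [f.app_d])),
    p.1.2.2.1.2.trans ((congrArg (f.app 1) p.2.2.1).trans (by simp only [f.app_d])),
    p.1.2.2.2.1.2.trans ((congrArg (f.app 1) p.2.2.2.1).trans (by simp only [f.app_d])),
    p.1.2.2.2.2.2.trans ((congrArg (f.app 1) p.2.2.2.2).trans (by simp only [f.app_d]))⟩

/-! ### Naturality of the pentagon and the coherency condition -/

theorem a_congr {p q : D.Y3} (h : p.1 = q.1) : D.a p = D.a q := congrArg D.a (Subtype.ext h)

theorem app_d_d (f : SimplicialMap X' X) {n : ℕ} (i : Fin (n + 2)) (j : Fin (n + 3))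
    (x : X'.obj (n + 2)) : f.app n (X'.d i (X'.d j x)) = X.d i (X.d j (f.app (n + 2) x)) := by
  rw [f.app_d, f.app_d]

/-- This and the next four lemmas treat the five associators of the pentagon. Naturality of `f`
matches the base simplex and, for the middle three, also the simplex below the inner product `m`. -/
theorem a_pt0_pullback (p : (D.pullback f).Y4) :
    ((D.pullback f).a ((D.pullback f).pt0 p)).1.2 = D.a (D.pt0 (pullbackY4 p)) :=
  a_congr (Prod.ext (f.app_d 0 p.1.1) rfl)

theorem a_pt1_pullback (p : (D.pullback f).Y4) :
    ((D.pullback f).a ((D.pullback f).pt1 p)).1.2 = D.a (D.pt1 (pullbackY4 p)) :=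
  a_congr (Prod.ext (f.app_d 1 p.1.1) (Prod.ext rfl (Prod.ext rfl
    (D.m_congr (Prod.ext (app_d_d f 3 4 p.1.1) rfl)))))

theorem a_pt2_pullback (p : (D.pullback f).Y4) :
    ((D.pullback f).a ((D.pullback f).pt2 p)).1.2 = D.a (D.pt2 (pullbackY4 p)) :=
  a_congr (Prod.ext (f.app_d 2 p.1.1) (Prod.ext rfl (Prod.ext
    (D.m_congr (Prod.ext (app_d_d f 3 0 p.1.1) rfl)) rfl)))

theorem a_pt3_pullback (p : (D.pullback f).Y4) :
    ((D.pullback f).a ((D.pullback f).pt3 p)).1.2 = D.a (D.pt3 (pullbackY4 p)) :=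
  a_congr (Prod.ext (f.app_d 3 p.1.1) (Prod.ext
    (D.m_congr (Prod.ext (app_d_d f 0 0 p.1.1) rfl)) rfl))

theorem a_pt4_pullback (p : (D.pullback f).Y4) :
    ((D.pullback f).a ((D.pullback f).pt4 p)).1.2 = D.a (D.pt4 (pullbackY4 p)) :=
  a_congr (Prod.ext (f.app_d 4 p.1.1) rfl)

/-- The identities are arbitrary, since the component in `Q` of the identity chosen for the pullback
is not by definition the one chosen for `D`. -/
theorem pentagonLeft_pullback (p : (D.pullback f).Y4) {e e' : (D.pullback f).Q}
    (he : (D.pullback f).IsIdentity e p.1.2.1)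
    (he' : (D.pullback f).IsIdentity e' p.1.2.2.2.2) :
    ((D.pullback f).pentagonLeft p e e' he he').1.2 =
      D.pentagonLeft (pullbackY4 p) e.1.2 e'.1.2 he.of_pullback he'.of_pullback :=
  BundleGerbeData.mul_congr (Prod.ext
    (MultiplicativeData.mhat_congr (Prod.ext (app_d_d f 1 1 p.1.1)
      (Prod.ext rfl (a_pt4_pullback p))))
    (BundleGerbeData.mul_congr (Prod.ext (a_pt2_pullback p)
      (MultiplicativeData.mhat_congr (Prod.ext (app_d_d f 2 2 p.1.1)
        (Prod.ext (a_pt0_pullback p) rfl))))))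

theorem pentagonRight_pullback (p : (D.pullback f).Y4) :
    ((D.pullback f).pentagonRight p).1.2 = D.pentagonRight (pullbackY4 p) :=
  BundleGerbeData.mul_congr (Prod.ext (a_pt1_pullback p) (a_pt3_pullback p))

/-- Uniqueness of identities frees the coherency condition from the chosen ones. -/
theorem IsSimplicialBundleGerbe.pentagon (hD : D.IsSimplicialBundleGerbe) (p : D.Y4) {e e' : D.Q}
    (he : D.IsIdentity e p.1.2.1) (he' : D.IsIdentity e' p.1.2.2.2.2) :
    D.pentagonLeft p e e' he he' = D.pentagonRight p := by
  obtain rfl := (hD.isBundleGerbe.existsUnique_identity _).unique he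
    (hD.isBundleGerbe.isIdentity_one _)
  obtain rfl := (hD.isBundleGerbe.existsUnique_identity _).unique he'
    (hD.isBundleGerbe.isIdentity_one _)
  exact hD.coherency p

/-- The pullback of a simplicial bundle gerbe along a smooth map of simplicial manifolds is a
simplicial bundle gerbe as soon as its underlying bundle gerbe consists of manifolds. -/
theorem IsSimplicialBundleGerbe.pullback (hD : D.IsSimplicialBundleGerbe) (hf : f.IsSmooth)
    (hX' : X'.IsSimplicialManifold) (hY : IsLocallySplit (D.pullback f).proj)
    (hQ : IsSmoothManifold (D.pullback f).Q) : (D.pullback f).IsSimplicialBundleGerbe where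
  isBundleGerbe := hD.isBundleGerbe.pullback hY hQ
  isMorphism := hD.isMorphism.pullback hf hX'
  isTransformation := hD.isTransformation.pullback hf hX'
  coherency p := by
    have h : ∀ {e e' : (D.pullback f).Q} (he : (D.pullback f).IsIdentity e p.1.2.1)
        (he' : (D.pullback f).IsIdentity e' p.1.2.2.2.2),
        (D.pullback f).pentagonLeft p e e' he he' = (D.pullback f).pentagonRight p :=
      -- The two sides lie over `d₁ d₂ d₂ x` and `d₁ d₂ d₃ x`, which agree by a simplicial identity.
      fun he he' => Subtype.ext (Prod.ext
        (congrArg (X'.d 1) (X'.d_d (i := 2) (j := 2) le_rfl p.1.1).symm)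
        ((pentagonLeft_pullback p he he').trans
          ((hD.pentagon _ _ _).trans (pentagonRight_pullback p).symm)))
    exact h _ _

end SimplicialBundleGerbeData

end BundleGerbes

/-- The pullback of a simplicial bundle gerbe on `NG` along the simplicial map `τ` of a principal
`G`-bundle `P → M` is a bundle 2-gerbe. -/
theorem mainTheorem7 {G P M : Type u} [Group G] [DiffeologicalSpace G] [DiffeologicalSpace P]
    [DiffeologicalSpace M] (hG : BundleGerbes.IsLieGroup G) (hM : BundleGerbes.IsSmoothManifold M)
    (π : P → M) (ρ : P → G → P) (hP : BundleGerbes.IsPrincipalBundle π ρ)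
    (S : BundleGerbes.SimplicialBundleGerbeData (BundleGerbes.nerve G))
    (hS : S.IsSimplicialBundleGerbe) :
    (BundleGerbes.tau hP).IsSmooth ∧
      BundleGerbes.IsBundleTwoGerbe π (S.pullback (BundleGerbes.tau hP)) := by
  have htau : (BundleGerbes.tau hP).IsSmooth := hP.dSmooth_tauFun hG
  have hPm := hP.manifold_total hG.manifold hM
  have hX : (BundleGerbes.cech π).IsSimplicialManifold :=
    ⟨hP.manifold_fibrePower hG hM, BundleGerbes.dSmooth_cech_map⟩
  -- Level `1` is enough for the manifold conditions on the gerbe, since `Y` and `Q` live over `NG₁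
  -- = G`.
  have htriv : BundleGerbes.IsTrivialProjection ((BundleGerbes.tau hP).app 1)
      (hP.fibrePowerEquiv 1) :=
    ⟨hP.dSmooth_fibrePowerEquiv hG 1, hP.dSmooth_fibrePowerEquiv_symm hG 1,
      hP.tauFun_fibrePowerEquiv 1⟩
  have hB := hS.isBundleGerbe
  have hQ : BundleGerbes.IsSmoothManifold (S.pullback (BundleGerbes.tau hP)).Q :=
    htriv.manifold_pullback hPm hB.manifold
      (hB.locallySplit.smooth.comp' hB.dSmooth_src)
  have hY : BundleGerbes.IsLocallySplit (S.pullback (BundleGerbes.tau hP)).proj :=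
    htriv.isLocallySplit_pullback (htau 1) hPm (hX.manifold 1) hB.locallySplit
  exact ⟨htau, hM, hPm, hP.isLocallySplit hG hM, hX, hY.manifold_total, hQ,
    hS.pullback htau hX hY hQ⟩
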